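/- Let $G$ be an infinite countable discrete amenable group, and let $L_0\supseteq L_1\supseteq\cdots$ be a sequence of finite index normal subgroups of $G$ with $\bigcap_n L_n=\{e\}$. Let $\tilde G=\varprojlim G/L_n$ be the associated profinite completion, $\tilde L_n$ the kernel of the projection $\tilde G\to G/L_n$, and let $G$ act on $\tilde G$ by left multiplication. Let $\mathcal G=\tilde G\rtimes G$ be the transformation groupoid: $(x,g)$ is an arrow with source $x$ and range $gx$, and $(x,g)(gx,h)=(x,hg)$. Then: (1) $\mathcal G$ is almost AF. That is, $\mathcal G$ is a Cantor groupoid (a second countable locally compact Hausdorff étale groupoid whose unit space is homeomorphic to the Cantor set), $C^*_r(\mathcal G)$ is simple, and $\mathcal G$ contains an open AF subgroupoid $\mathcal G_{AF}$ with the same unit space (AF: an increasing union of a sequence of compact open principal subgroupoids, each containing the unit space) such that for every compact $C\subseteq\mathcal G\setminus\mathcal G_{AF}$ and every $m\ge1$ there are compact sets $C_1,\dots,C_m\subseteq\mathcal G_{AF}$, on each of which the source and range maps $s,r$ are injective, with $s(C_i)=s(C)$ for all $i$ and with pairwise disjoint ranges $r(C_i)$. (2) There are finite sets $K_n\subseteq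 G$ $(n\ge 0)$ with $\bigcup_n K_n=G$ and integers $n_1<n_2<\cdots$ such that: (a) $|K_n\triangle sK_n|/|K_n|\to0$ for all $s\in G$; (b) for every $n$, each element of $G$ is uniquely a product of an element of $K_n$ and an element of $L_n$; (c) for every $k$, $K_{n_{k+1}}$ is a disjoint union of right translates $K_{n_k}l$ with $l\in L_{n_k}$. (3) For all finite sets $K_n$ and integers $n_1<n_2<\cdots$ with (a), (b), (c), the sets $\mathcal G_n=\{(gx,g_1g^{-1}) : x\in\tilde L_n,\ g,g_1\in K_n\}$ are compact open subgroupoids of $\mathcal G$ with the same unit space, $\mathcal G_{n_k}\subseteq\mathcal G_{n_{k+1}}$ for all $k$, and $\mathcal G_{AF}=\bigcup_k\mathcal G_{n_k}$ has the properties required in (1). -/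

import Mathlib

open Filter Topology

universe u

/-! ## Groupoids -/

/-- A groupoid on the set `Γ` of its arrows. The product `mul x y` is meaningful only for
composable pairs, i.e. when `x⁻¹ x = y y⁻¹`; its values on other pairs are irrelevant (all the
notions below only look at products of composable pairs). -/
structure ArrowGroupoid (Γ : Type u) where
  mul : Γ → Γ → Γ
  inv : Γ → Γ
  inv_inv : ∀ x, inv (inv x) = x
  comp_assoc_left : ∀ x y z, mul (inv x) x = mul y (inv y) → mul (inv y) y = mul z (inv z) →
    mul (inv (mul x y)) (mul x y) = mul z (inv z)
  comp_assoc_right : ∀ x y z, mul (inv x) x = mul y (inv y) → mul (inv y) y = mul z (inv z) →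
    mul (inv x) x = mul (mul y z) (inv (mul y z))
  mul_assoc : ∀ x y z, mul (inv x) x = mul y (inv y) → mul (inv y) y = mul z (inv z) →
    mul (mul x y) z = mul x (mul y z)
  inv_mul_cancel : ∀ x y, mul (inv x) x = mul y (inv y) → mul (inv x) (mul x y) = y
  mul_inv_cancel : ∀ x y, mul (inv x) x = mul y (inv y) → mul (mul x y) (inv y) = x

namespace ArrowGroupoid

variable {Γ : Type u} (𝒢 : ArrowGroupoid Γ)

/-- The source `s(x) = x x⁻¹`. -/
def src (x : Γ) : Γ := 𝒢.mul x (𝒢.inv x)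

/-- The range `r(x) = x⁻¹ x`. -/
def rng (x : Γ) : Γ := 𝒢.mul (𝒢.inv x) x

/-- `(x, y)` is a composable pair. -/
def Comp (x y : Γ) : Prop := 𝒢.rng x = 𝒢.src y

/-- The unit space (every `x x⁻¹` is of the form `y⁻¹ y`, with `y = x⁻¹`, and conversely). -/
def units : Set Γ := Set.range 𝒢.src

/-- `H` is a subgroupoid with the same unit space as `𝒢`. -/
structure IsWideSubgroupoid (H : Set Γ) : Prop where
  mul_mem : ∀ x ∈ H, ∀ y ∈ H, 𝒢.Comp x y → 𝒢.mul x y ∈ H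
  inv_mem : ∀ x ∈ H, 𝒢.inv x ∈ H
  units_subset : 𝒢.units ⊆ H

/-- `H` is principal: an arrow in `H` is determined by its end points. -/
def IsPrincipalOn (H : Set Γ) : Prop :=
  ∀ x ∈ H, ∀ y ∈ H, 𝒢.src x = 𝒢.src y → 𝒢.rng x = 𝒢.rng y → x = y

/-- A graph: source and range maps are injective on `C`. -/
def IsGraph (C : Set Γ) : Prop := Set.InjOn 𝒢.src C ∧ Set.InjOn 𝒢.rng C

section Topological

variable [TopologicalSpace Γ]

/-- A Cantor groupoid: a second countable locally compact Hausdorff étale topological groupoid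
whose unit space is homeomorphic to the Cantor set. (On an étale groupoid the counting measures
on the fibres of the range or source map always form a Haar system.) -/
structure IsCantor : Prop where
  secondCountable : SecondCountableTopology Γ
  locallyCompact : LocallyCompactSpace Γ
  hausdorff : T2Space Γ
  continuous_inv : Continuous 𝒢.inv
  continuousOn_mul : ContinuousOn (fun p : Γ × Γ => 𝒢.mul p.1 p.2) {p | 𝒢.Comp p.1 p.2}
  etale : IsLocalHomeomorph (Set.rangeFactorization 𝒢.src)
  units_cantor : Nonempty (𝒢.units ≃ₜ cantorSet)

/-- For a subgroupoid `H` of a Cantor groupoid which is open and has the same unit space (so that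
it is itself a Cantor groupoid): `H` is AF if it is the increasing union of a sequence of compact
open principal subgroupoids, each containing the unit space. -/
def IsAF (H : Set Γ) : Prop :=
  ∃ A : ℕ → Set Γ, Monotone A ∧
    (∀ k, 𝒢.IsWideSubgroupoid (A k) ∧ IsCompact (A k) ∧ IsOpen (A k) ∧ 𝒢.IsPrincipalOn (A k)) ∧
    ⋃ k, A k = H

/-- `H` is an open AF subgroupoid with the same unit space such that compact sets outside `H` are
small: their source can be pushed inside `H` along any number of compact graphs with the same
source and pairwise disjoint ranges. -/
structure IsLargeAFSubgroupoid (H : Set Γ) : Prop where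
  wide : 𝒢.IsWideSubgroupoid H
  isOpen : IsOpen H
  isAF : 𝒢.IsAF H
  graphs : ∀ C : Set Γ, IsCompact C → C ⊆ Hᶜ → ∀ m : ℕ, 1 ≤ m → ∃ D : Fin m → Set Γ,
    (∀ i, IsCompact (D i) ∧ D i ⊆ H ∧ 𝒢.IsGraph (D i) ∧ 𝒢.src '' D i = 𝒢.src '' C) ∧
    Pairwise fun i j => Disjoint (𝒢.rng '' D i) (𝒢.rng '' D j)

/-! ### The reduced C*-algebra -/

/-- The Hilbert space `ℓ²(Γ)`, the direct sum of the `ℓ²(r⁻¹(u))` over all units `u`. -/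
abbrev ell2 (Γ : Type u) : Type u := lp (fun _ : Γ => ℂ) 2

open Classical in
/-- `T` is the operator `λ(f)` of left convolution by `f`, for the counting measures: its matrix
coefficient at `(γ, β)` is `f (γ β⁻¹)` if `γ β⁻¹` makes sense (i.e. `γ` and `β` have the same
range), and `0` otherwise. This is the direct sum over all units of the regular representations. -/
def IsConvolutionBy (f : Γ → ℂ) (T : ell2 Γ →L[ℂ] ell2 Γ) : Prop :=
  ∀ β γ : Γ, T (lp.single 2 β (1 : ℂ)) γ =
    if 𝒢.Comp γ (𝒢.inv β) then f (𝒢.mul γ (𝒢.inv β)) else 0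

/-- The reduced C*-algebra `C*_r(𝒢)` of an étale groupoid: the closed *-algebra of operators on
`ℓ²(Γ)` generated by the convolution operators `λ(f)`, `f ∈ C_c(𝒢)`. -/
noncomputable def reducedCStar : NonUnitalStarSubalgebra ℂ (ell2 Γ →L[ℂ] ell2 Γ) :=
  (NonUnitalStarAlgebra.adjoin ℂ {T : ell2 Γ →L[ℂ] ell2 Γ |
    ∃ f : Γ → ℂ, Continuous f ∧ HasCompactSupport f ∧ 𝒢.IsConvolutionBy f T}).topologicalClosure

/-- `C*_r(𝒢)` is a simple C*-algebra: it is nonzero and has no closed two-sided ideals besides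
`0` and itself. -/
def HasSimpleReducedCStar : Prop :=
  Nontrivial 𝒢.reducedCStar ∧
    ∀ I : TwoSidedIdeal 𝒢.reducedCStar, IsClosed {a | a ∈ I} → I = ⊥ ∨ I = ⊤

/-- An almost AF groupoid: a Cantor groupoid with simple reduced C*-algebra which contains a large
open AF subgroupoid with the same unit space. -/
structure IsAlmostAF : Prop where
  isCantor : 𝒢.IsCantor
  simple : 𝒢.HasSimpleReducedCStar
  exists_large : ∃ H : Set Γ, 𝒢.IsLargeAFSubgroupoid H

end Topological

end ArrowGroupoid

/-- The transformation groupoid `X ⋊ G`: `(x, g)` is an arrow from `x` to `g x`, the product is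
`(x, g) (g x, h) = (x, h g)` and the inverse is `(x, g)⁻¹ = (g x, g⁻¹)`. Its topology is the product
topology of `X × G`. -/
def transformationGroupoid (X G : Type u) [Group G] [MulAction G X] : ArrowGroupoid (X × G) where
  mul p q := (p.1, q.2 * p.2)
  inv p := (p.2 • p.1, p.2⁻¹)
  inv_inv := by rintro ⟨x, g⟩; simp
  comp_assoc_left := by
    rintro ⟨x, g⟩ ⟨y, h⟩ ⟨z, k⟩ h1 h2
    simp only [Prod.mk.injEq] at h1 h2 ⊢
    simp [mul_smul, h1.1, h2.1]
  comp_assoc_right := by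
    rintro ⟨x, g⟩ ⟨y, h⟩ ⟨z, k⟩ h1 h2
    simp only [Prod.mk.injEq] at h1 h2 ⊢
    simp [h1.1]
  mul_assoc := by
    rintro ⟨x, g⟩ ⟨y, h⟩ ⟨z, k⟩ h1 h2
    simp [_root_.mul_assoc]
  inv_mul_cancel := by
    rintro ⟨x, g⟩ ⟨y, h⟩ h1
    simp only [Prod.mk.injEq] at h1 ⊢
    simp [h1.1]
  mul_inv_cancel := by
    rintro ⟨x, g⟩ ⟨y, h⟩ h1
    simp

/-! ## Følner sequences -/

section Groups

variable {G : Type u} [Group G]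

/-- `|F_n ∆ s F_n| / |F_n| → 0` for all `s`. -/
def IsLeftFolner (F : ℕ → Finset G) : Prop :=
  ∀ s : G, Tendsto (fun n => (symmDiff (F n : Set G) ((fun x => s * x) '' (F n : Set G))).ncard /
    ((F n).card : ℝ)) atTop (𝓝 0)

/-- `|F_n ∆ F_n s| / |F_n| → 0` for all `s`. -/
def IsRightFolner (F : ℕ → Finset G) : Prop :=
  ∀ s : G, Tendsto (fun n => (symmDiff (F n : Set G) ((fun x => x * s) '' (F n : Set G))).ncard /
    ((F n).card : ℝ)) atTop (𝓝 0)

/-- Amenability of a (countable discrete) group: there are finite sets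
`1 ∈ F_0 ⊆ F_1 ⊆ ⋯` with union `G` which form a right Følner sequence. -/
def IsAmenableGroup (G : Type u) [Group G] : Prop :=
  ∃ F : ℕ → Finset G, 1 ∈ F 0 ∧ Monotone F ∧ (∀ g, ∃ n, g ∈ F n) ∧ IsRightFolner F

/-- Finite sets `K n` and indices `ν 0 < ν 1 < ⋯` such that `(K n)` is left Følner,
`G = (K n) (L n)` is a tiling for all `n` (every element of `G` is uniquely `a * b` with `a ∈ K n`,
`b ∈ L n`), and `K (ν (k + 1))` is a disjoint union of right translates of `K (ν k)`,
by elements of `L (ν k)`. -/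
structure IsFolnerTiling (L : ℕ → Subgroup G) (K : ℕ → Finset G) (ν : ℕ → ℕ) : Prop where
  leftFolner : IsLeftFolner K
  tiling : ∀ n, Subgroup.IsComplement (K n : Set G) (L n : Set G)
  strictMono : StrictMono ν
  refine : ∀ k, ∃ T : Finset G, (T : Set G) ⊆ L (ν k) ∧
    (T : Set G).PairwiseDisjoint (fun t => (fun x => x * t) '' (K (ν k) : Set G)) ∧
    (K (ν (k + 1)) : Set G) = ⋃ t ∈ T, (fun x => x * t) '' (K (ν k) : Set G)

/-! ## Profinite completions -/

variable (L : ℕ → Subgroup G) [∀ n, (L n).Normal] (hL : Antitone L)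

/-- The profinite completion of `G` with respect to the decreasing sequence `L` of normal
subgroups: the inverse limit of the groups `G ⧸ L n`. When `G` is discrete so is `G ⧸ L n`,
and the topology is the one induced by the product topology. -/
def profiniteCompletion : Subgroup (∀ n, G ⧸ L n) where
  carrier := {x | ∀ n m (h : n ≤ m),
    QuotientGroup.map (L m) (L n) (MonoidHom.id G) (hL h) (x m) = x n}
  one_mem' := fun n m h => by simp
  mul_mem' := fun {x y} hx hy n m h => by
    rw [Pi.mul_apply, map_mul, hx n m h, hy n m h, Pi.mul_apply]
  inv_mem' := fun {x} hx n m h => by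
    rw [Pi.inv_apply, map_inv, hx n m h, Pi.inv_apply]

/-- The canonical homomorphism from `G` to its profinite completion. -/
def toCompletion : G →* profiniteCompletion L hL where
  toFun g := ⟨fun n => (g : G ⧸ L n), fun _ _ _ => rfl⟩
  map_one' := rfl
  map_mul' _ _ := rfl

/-- `G` acts on its profinite completion by left multiplication. -/
instance completionAction : MulAction G (profiniteCompletion L hL) :=
  MulAction.compHom _ (toCompletion L hL)

/-- The transformation groupoid of `G` acting on its profinite completion. -/
abbrev completionGroupoid : ArrowGroupoid (profiniteCompletion L hL × G) :=
  transformationGroupoid (profiniteCompletion L hL) G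

/-- The set of all arrows `(g x, g₁ g⁻¹)` with `g, g₁ ∈ K n` and `x` in the kernel of the
projection of the profinite completion onto `G ⧸ L n`. -/
def tileSubgroupoid (K : ℕ → Finset G) (n : ℕ) : Set (profiniteCompletion L hL × G) :=
  {p | ∃ x : profiniteCompletion L hL, x.1 n = 1 ∧ ∃ g ∈ K n, ∃ g₁ ∈ K n, p = (g • x, g₁ * g⁻¹)}

end Groups

/-! Everything about tilings rests on transversals of deep normal subgroups that are almost
invariant on the left, and a random order produces them. Let `E` be a finite subset of `H`, almost
invariant on the right, that embeds in the finite quotient `Q`. Enumerate `Q` at random and let `c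
x` be the first point of `E x`. The first point of `E x ∪ E s x` is uniformly distributed there, so
`c x ≠ c (s x)` has probability at most `|E ∆ E s| / |E|`. Write `c x = e x * x` with `e x ∈ E` and
lift `x` to `(e x)⁻¹` times a fixed lift of `c x`. Where `c x = c (s x)`, the lift of `s x` is `s`
times the lift of `x`; so some enumeration gives a section with almost invariant image
(`exists_almost_invariant_section`). Inside `L a`, whose Følner sets are slices of those of `G`,
this yields sets `T` such that `K T` is almost invariant for a given transversal `K` of `L a`
(`eventually_exists_refinement`). Iteration gives nested tilings.

At level `n` a point of the completion has a unique position in `K n`, and an arrow lies in the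
`n`-th subgroupoid when its group element moves the position of its source within `K n`. A compact
set outside the union involves finitely many group elements, so its sources have positions near the
boundary of `K n`. By the Følner property, `m` disjoint copies of this boundary fit into `K n` for a
suitable `n = ν k`; moving positions there gives the graphs (`IsFolnerTiling.isLargeAFSubgroupoid`).

For simplicity, the action is free because the `L n` intersect trivially. Hence compressing an
operator `T` of the reduced algebra by the projection `Q` of a small cylinder leaves, up to a small
error, a diagonal coefficient of `T` times `Q` (`eventually_norm_compress_le`). If `a ≠ 0` lies in a
closed ideal, some diagonal coefficient of `a* a` is positive, so the ideal contains some `Q`, then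
its conjugates under `G`, and then their sum `1`. -/

/-! ### First elements in a random enumeration -/

section RandomOrder

/-- The element of a nonempty finite set which comes first in the enumeration `π`. -/
noncomputable def firstElement {Q : Type*} {N : ℕ} (π : Q ≃ Fin N) (A : Finset Q)
    (hA : A.Nonempty) : Q :=
  (A.exists_min_image π hA).choose

theorem firstElement_mem {Q : Type*} {N : ℕ} (π : Q ≃ Fin N) (A : Finset Q) (hA : A.Nonempty) :
    firstElement π A hA ∈ A :=
  (A.exists_min_image π hA).choose_spec.1

theorem firstElement_le {Q : Type*} {N : ℕ} (π : Q ≃ Fin N) (A : Finset Q) (hA : A.Nonempty)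
    {v : Q} (hv : v ∈ A) : π (firstElement π A hA) ≤ π v :=
  (A.exists_min_image π hA).choose_spec.2 v hv

theorem firstElement_eq {Q : Type*} {N : ℕ} (π : Q ≃ Fin N) (A : Finset Q) (hA : A.Nonempty)
    {u : Q} (hu : u ∈ A) (h : ∀ v ∈ A, π u ≤ π v) : firstElement π A hA = u :=
  π.injective (le_antisymm (firstElement_le π A hA hu) (h _ (firstElement_mem π A hA)))

open Classical in
-- Exchanging `u` and `u'` before enumerating turns enumerations in which `u` comes first in `U`
-- into ones in which `u'` does. By symmetry, the first element of `U` is uniformly distributed.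
theorem card_firstElement_eq_le {Q : Type*} [Fintype Q] {N : ℕ} (U : Finset Q) (hU : U.Nonempty)
    {u u' : Q} (hu : u ∈ U) (hu' : u' ∈ U) :
    (Finset.univ.filter fun π : Q ≃ Fin N => firstElement π U hU = u).card ≤
      (Finset.univ.filter fun π : Q ≃ Fin N => firstElement π U hU = u').card := by
  refine Finset.card_le_card_of_injOn (fun π => (Equiv.swap u u').trans π) ?_ ?_
  · intro π hπ
    simp only [Finset.coe_filter, Finset.mem_univ, true_and, Set.mem_ofPred_eq] at hπ ⊢
    refine firstElement_eq _ _ _ hu' fun v hv => ?_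
    simp only [Equiv.trans_apply, Equiv.swap_apply_right]
    rw [← hπ]
    apply firstElement_le
    rw [hπ]
    rw [Equiv.swap_apply_def]
    split_ifs <;> assumption
  · intro π _ π' _ h
    ext x
    have := congrArg (fun e : Q ≃ Fin N => e (Equiv.swap u u' x)) h
    simpa using congrArg Fin.val this

open Classical in
/-- In a random enumeration, the first elements of `A` and `B` differ with probability at most
`|A ∆ B| / |A ∪ B|`. -/
theorem card_firstElement_ne_mul_le {Q : Type*} [Fintype Q] {N : ℕ} (A B : Finset Q)
    (hA : A.Nonempty) (hB : B.Nonempty) :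
    (Finset.univ.filter fun π : Q ≃ Fin N => firstElement π A hA ≠ firstElement π B hB).card *
      (A ∪ B).card ≤ (symmDiff A B).card * Fintype.card (Q ≃ Fin N) := by
  have hU : (A ∪ B).Nonempty := hA.mono Finset.subset_union_left
  obtain ⟨u₀, hu₀⟩ := hU
  set c := (Finset.univ.filter fun π : Q ≃ Fin N => firstElement π (A ∪ B) ⟨u₀, hu₀⟩ = u₀).card
    with hc
  have hcu : ∀ u ∈ A ∪ B,
      (Finset.univ.filter fun π : Q ≃ Fin N => firstElement π (A ∪ B) ⟨u₀, hu₀⟩ = u).card = c :=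
    fun u hu => le_antisymm (card_firstElement_eq_le _ _ hu hu₀) (card_firstElement_eq_le _ _ hu₀ hu)
  have htot : Fintype.card (Q ≃ Fin N) = (A ∪ B).card * c := by
    rw [← Finset.card_univ, Finset.card_eq_sum_card_fiberwise (t := A ∪ B)
      (f := fun π : Q ≃ Fin N => firstElement π (A ∪ B) ⟨u₀, hu₀⟩)
      (fun π _ => firstElement_mem _ _ _), Finset.sum_congr rfl hcu, Finset.sum_const, smul_eq_mul]
  have hbad : (Finset.univ.filter fun π : Q ≃ Fin N =>
      firstElement π A hA ≠ firstElement π B hB).card ≤ (symmDiff A B).card * c := by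
    calc _ ≤ (Finset.univ.filter fun π : Q ≃ Fin N =>
          firstElement π (A ∪ B) ⟨u₀, hu₀⟩ ∈ symmDiff A B).card := by
          refine Finset.card_le_card fun π hπ => ?_
          simp only [Finset.mem_filter, Finset.mem_univ, true_and] at hπ ⊢
          -- If the first element of `A ∪ B` lies in both sets, it is the first element of each.
          by_contra hcon
          set u := firstElement π (A ∪ B) ⟨u₀, hu₀⟩ with hu
          have hmem : u ∈ A ∪ B := firstElement_mem _ _ _
          have hle : ∀ v ∈ A ∪ B, π u ≤ π v := fun v hv => firstElement_le π _ _ hv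
          have h2 : u ∈ A ∧ u ∈ B := by
            rw [Finset.mem_symmDiff] at hcon
            rw [Finset.mem_union] at hmem
            tauto
          apply hπ
          rw [firstElement_eq π A hA h2.1 fun v hv => hle v (Finset.mem_union_left _ hv),
            firstElement_eq π B hB h2.2 fun v hv => hle v (Finset.mem_union_right _ hv)]
      _ = (symmDiff A B).card * c := by
          rw [Finset.card_eq_sum_card_fiberwise (t := symmDiff A B)
            (f := fun π : Q ≃ Fin N => firstElement π (A ∪ B) ⟨u₀, hu₀⟩)
            (fun π hπ => by simpa only [Finset.coe_filter, Finset.mem_univ, true_and, Set.mem_ofPred_eq, Finset.mem_coe] using hπ), ← smul_eq_mul, ← Finset.sum_const]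
          refine Finset.sum_congr rfl fun u hu => ?_
          rw [Finset.filter_filter, ← hcu u (by
            rw [Finset.mem_symmDiff] at hu; rw [Finset.mem_union]; tauto)]
          congr 1
          ext π
          simp only [Finset.mem_filter, Finset.mem_univ, true_and]
          exact ⟨fun h => h.2, fun h => ⟨h ▸ hu, h⟩⟩
  calc _ ≤ (symmDiff A B).card * c * (A ∪ B).card := Nat.mul_le_mul_right _ hbad
    _ = _ := by rw [htot]; ring

end RandomOrder

/-! ### Almost invariant transversals of deep subgroups -/

section Transversals

open Classical in
/-- A section of a finite quotient which is equivariant up to a small error, obtained from the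
partition of the quotient into the cells of a random order. -/
theorem exists_almost_invariant_section {H Q : Type*} [Group H] [Group Q] [Fintype Q]
    (q : H →* Q) (hq : Function.Surjective q) (E S : Finset H) (hE : E.Nonempty)
    (h1 : ∀ e ∈ E, ∀ e' ∈ E, q e' = q e → e' = e)
    (hS : ∀ e ∈ E, ∀ e' ∈ E, ∀ s ∈ S, q (e' * s) = q e → e' * s = e) :
    ∃ k : Q → H, (∀ x, q (k x) = x) ∧
      (∑ s ∈ S, ((Finset.univ.image k).image (s * ·) \ Finset.univ.image k).card) * E.card ≤
        Fintype.card Q * ∑ s ∈ S, (symmDiff E (E.image (· * s))).card := by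
  set n := Fintype.card Q with hn
  -- Right almost invariance of `E` makes `A x` and `A (q s * x)` nearly equal, so they usually
  -- share their first element `c π x`, the centre of the cell of `x`.
  let A : Q → Finset Q := fun x => E.image fun e => q e * x
  have hA : ∀ x, (A x).Nonempty := fun x => hE.image fun e => q e * x
  have hAcard : ∀ x, (A x).card = E.card := by
    intro x
    refine Finset.card_image_of_injOn fun e he e' he' h => ?_
    exact h1 _ he' _ he (mul_right_cancel h)
  let c : (Q ≃ Fin n) → Q → Q := fun π x => firstElement π (A x) (hA x)
  have hcount : ∀ (s : H) (x : Q),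
      (Finset.univ.filter fun π : Q ≃ Fin n => c π x ≠ c π (q s * x)).card * E.card ≤
        (symmDiff E (E.image (· * s))).card * Fintype.card (Q ≃ Fin n) := by
    intro s x
    have h := card_firstElement_ne_mul_le (N := n) (A x) (A (q s * x)) (hA _) (hA _)
    refine (Nat.mul_le_mul_left _ ?_).trans (h.trans (Nat.mul_le_mul_right _ ?_))
    · rw [← hAcard x]
      exact Finset.card_le_card Finset.subset_union_left
    · refine (Finset.card_le_card (t := (symmDiff E (E.image (· * s))).image
        fun e => q e * x) ?_).trans Finset.card_image_le
      have : A (q s * x) = (E.image (· * s)).image fun e => q e * x := by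
        simp only [A, Finset.image_image]
        refine Finset.image_congr fun e _ => ?_
        simp [mul_assoc]
      rw [this]
      intro y hy
      simp only [A, Finset.mem_symmDiff, Finset.mem_image] at hy ⊢
      rcases hy with ⟨⟨e, he, rfl⟩, h⟩ | ⟨⟨e, he, rfl⟩, h⟩
      · exact ⟨e, Or.inl ⟨he, fun h' => h ⟨e, h', rfl⟩⟩, rfl⟩
      · exact ⟨e, Or.inr ⟨he, fun h' => h ⟨e, h', rfl⟩⟩, rfl⟩
  -- Some enumeration does no worse than the average over all of them.
  obtain ⟨π, hπ⟩ : ∃ π : Q ≃ Fin n,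
      (∑ s ∈ S, (Finset.univ.filter fun x => c π x ≠ c π (q s * x)).card) * E.card ≤
        n * ∑ s ∈ S, (symmDiff E (E.image (· * s))).card := by
    have hne : (Finset.univ : Finset (Q ≃ Fin n)).Nonempty := ⟨Fintype.equivFin Q, by simp⟩
    obtain ⟨π, -, hπ⟩ := Finset.exists_le_of_sum_le hne (f := fun π : Q ≃ Fin n =>
      (∑ s ∈ S, (Finset.univ.filter fun x => c π x ≠ c π (q s * x)).card) * E.card)
      (g := fun _ => n * ∑ s ∈ S, (symmDiff E (E.image (· * s))).card) (by
        rw [Finset.sum_const, ← Finset.sum_mul, Finset.sum_comm, Finset.sum_mul, Finset.mul_sum,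
          Finset.smul_sum]
        refine Finset.sum_le_sum fun s _ => ?_
        have hdouble : ∑ π : Q ≃ Fin n, (Finset.univ.filter fun x => c π x ≠ c π (q s * x)).card =
            ∑ x : Q, (Finset.univ.filter fun π : Q ≃ Fin n => c π x ≠ c π (q s * x)).card := by
          simp only [Finset.card_filter]
          exact Finset.sum_comm
        rw [hdouble, Finset.sum_mul]
        refine (Finset.sum_le_sum fun x _ => hcount s x).trans (le_of_eq ?_)
        rw [Finset.sum_const, smul_eq_mul, smul_eq_mul, Finset.card_univ, Finset.card_univ]
        ring)
    exact ⟨π, hπ⟩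
  have hex : ∀ x, ∃ e ∈ E, q e * x = c π x := fun x =>
    Finset.mem_image.mp (firstElement_mem π (A x) (hA x))
  choose e heE he using hex
  -- Within one cell all lifts start from the same lift of the centre, which makes `k` equivariant
  -- there.
  let k : Q → H := fun x => (e x)⁻¹ * Function.surjInv hq (c π x)
  have hk : ∀ x, q (k x) = x := by
    intro x
    simp only [k, map_mul, map_inv, Function.surjInv_eq]
    rw [← he x]
    simp
  refine ⟨k, hk, (Nat.mul_le_mul_right _ (Finset.sum_le_sum fun s hs => ?_)).trans hπ⟩
  refine (Finset.card_le_card (t := (Finset.univ.filter fun x => c π x ≠ c π (q s * x)).image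
    fun x => s * k x) ?_).trans Finset.card_image_le
  intro y hy
  simp only [Finset.mem_sdiff, Finset.mem_image, Finset.mem_univ, true_and, Finset.mem_filter]
    at hy ⊢
  obtain ⟨⟨_, ⟨x, rfl⟩, rfl⟩, hy⟩ := hy
  refine ⟨x, fun hc => hy ⟨q s * x, ?_⟩, rfl⟩
  -- When the centres agree, this identity holds in `Q`, and `hS` lifts it to `H`. It says that `k
  -- (q s * x) = s * k x`.
  have h2 : e (q s * x) * s = e x := by
    refine hS _ (heE _) _ (heE _) s hs ?_
    apply mul_right_cancel (b := x)
    rw [he x, hc, ← he (q s * x), map_mul, mul_assoc]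
  simp only [k]
  rw [← hc, ← h2]
  group

open Classical in
/-- A transversal which is invariant under left multiplication up to a small error. -/
theorem exists_almost_invariant_transversal {H : Type*} [Group H] (N : Subgroup H) [N.Normal]
    [N.FiniteIndex] (E S : Finset H) (hE : E.Nonempty)
    (h1 : ∀ e ∈ E, ∀ e' ∈ E, (e' : H ⧸ N) = e → e' = e)
    (hS : ∀ e ∈ E, ∀ e' ∈ E, ∀ s ∈ S, ((e' * s : H) : H ⧸ N) = e → e' * s = e) :
    ∃ K : Finset H, Subgroup.IsComplement (K : Set H) (N : Set H) ∧
      (∑ s ∈ S, (K.image (s * ·) \ K).card) * E.card ≤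
        K.card * ∑ s ∈ S, (symmDiff E (E.image (· * s))).card := by
  have : Fintype (H ⧸ N) := Subgroup.fintypeQuotientOfFiniteIndex
  obtain ⟨k, hk, hle⟩ := exists_almost_invariant_section (QuotientGroup.mk' N)
    (QuotientGroup.mk'_surjective N) E S hE h1 hS
  have hkinj : Function.Injective k := fun x y h => by rw [← hk x, h, hk y]
  refine ⟨Finset.univ.image k, ?_, ?_⟩
  · rw [Finset.coe_image, Finset.coe_univ, Set.image_univ]
    exact Subgroup.isComplement_range_left hk
  · rwa [Finset.card_image_of_injective _ hkinj, Finset.card_univ]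

/-- For every finite set, the subgroups of a separating decreasing sequence eventually meet it
trivially. -/
theorem eventually_inter_trivial {H : Type*} [Group H] (M : ℕ → Subgroup H) (hM : Antitone M)
    (hsep : ⨅ n, M n = ⊥) (P : Set H) (hP : P.Finite) :
    ∀ᶠ n in atTop, ∀ p ∈ P, p ∈ M n → p = 1 := by
  refine (Set.Finite.eventually_all hP).mpr fun p _ => ?_
  by_cases hp : p = 1
  · exact Eventually.of_forall fun _ _ => hp
  · obtain ⟨n, hn⟩ : ∃ n, p ∉ M n := by
      by_contra! h
      exact hp (by simpa [hsep] using (Subgroup.mem_iInf.mpr h : p ∈ ⨅ n, M n))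
    filter_upwards [eventually_ge_atTop n] with m hm hpm
    exact absurd (hM hm hpm) hn

/-- There are finite sets which are almost invariant under right multiplication. -/
def HasRightFolnerSets (H : Type*) [Group H] : Prop :=
  open Classical in
  ∀ S : Finset H, ∀ ε : ℝ, 0 < ε → ∃ E : Finset H, E.Nonempty ∧
    ∑ s ∈ S, ((symmDiff E (E.image (· * s))).card : ℝ) ≤ ε * E.card

open Classical in
theorem ncard_symmDiff_image {H : Type*} (F : Finset H) (f : H → H) :
    (symmDiff (F : Set H) (f '' F)).ncard = (symmDiff F (F.image f)).card := by
  rw [← Set.ncard_coe_finset, Finset.coe_symmDiff, Finset.coe_image]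

open Classical in
-- Right multiplication by elements of `H` preserves each coset `g H`, so the defect of a Følner set
-- `F` of `G` is the sum of the defects of its slices. Some slice therefore has at most the average
-- relative defect; translating it by `g⁻¹` puts it into `H`.
theorem IsAmenableGroup.hasRightFolnerSets_subgroup {G : Type u} [Group G] (hG : IsAmenableGroup G)
    (H : Subgroup G) : HasRightFolnerSets H := by
  intro S ε hε
  obtain ⟨F, h1, hmono, -, hF⟩ := hG
  have hlim : Tendsto (fun n => ∑ s ∈ S, ((symmDiff (F n) ((F n).image (· * (s : G)))).card : ℝ) /
      (F n).card) atTop (𝓝 0) := by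
    rw [← Finset.sum_const_zero (s := S)]
    refine tendsto_finsetSum _ fun s _ => ?_
    simpa only [ncard_symmDiff_image] using hF s
  obtain ⟨n, hn⟩ := (hlim.eventually (gt_mem_nhds hε)).exists
  have hpos : 0 < (F n).card := Finset.card_pos.mpr ⟨1, hmono (Nat.zero_le n) h1⟩
  rw [← Finset.sum_div, div_lt_iff₀ (by exact_mod_cast hpos)] at hn
  generalize F n = F at hn hpos
  let c : G → G ⧸ H := fun g => g
  obtain ⟨r, hr, hle⟩ : ∃ r ∈ F.image c,
      ∑ s ∈ S, ((symmDiff (F.filter (c · = r)) ((F.filter (c · = r)).image (· * (s : G)))).card : ℝ)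
        ≤ ε * (F.filter (c · = r)).card := by
    refine Finset.exists_le_of_sum_le ((Finset.card_pos.mp hpos).image c) ?_
    rw [Finset.sum_comm, ← Finset.mul_sum]
    have e1 : ∑ r ∈ F.image c, ((F.filter (c · = r)).card : ℝ) = F.card := by
      rw [Finset.card_eq_sum_card_image c F]
      push_cast
      rfl
    rw [e1]
    refine le_trans (Finset.sum_le_sum fun s _ => ?_) hn.le
    rw [← Nat.cast_sum, Nat.cast_le, ← Finset.card_biUnion]
    · refine Finset.card_le_card fun x hx => ?_
      have hcs : ∀ a, c (a * s) = c a := fun a => by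
        simp [c, QuotientGroup.mk_mul_of_mem a s.2]
      simp only [Finset.mem_biUnion, Finset.mem_symmDiff, Finset.mem_image, Finset.mem_filter]
        at hx ⊢
      obtain ⟨r, -, ⟨⟨hxF, hxr⟩, h⟩ | ⟨⟨a, ⟨haF, har⟩, rfl⟩, h⟩⟩ := hx
      · refine Or.inl ⟨hxF, ?_⟩
        rintro ⟨a, ha, rfl⟩
        exact h ⟨a, ⟨ha, by rw [← hcs a, hxr]⟩, rfl⟩
      · exact Or.inr ⟨⟨a, haF, rfl⟩, fun h' => h ⟨h', by rw [hcs, har]⟩⟩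
    · intro r _ r' _ hrr'
      rw [Function.onFun, Finset.disjoint_left]
      have key : ∀ r x, x ∈ symmDiff (F.filter (c · = r)) ((F.filter (c · = r)).image
          (· * (s : G))) → c x = r := by
        intro r x hx
        simp only [Finset.mem_symmDiff, Finset.mem_image, Finset.mem_filter] at hx
        obtain ⟨⟨-, hxr⟩, -⟩ | ⟨⟨a, ⟨-, har⟩, rfl⟩, -⟩ := hx
        · exact hxr
        · rw [← har]
          simp [c, QuotientGroup.mk_mul_of_mem a s.2]
      exact fun x hx hx' => hrr' ((key r x hx).symm.trans (key r' x hx'))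
  obtain ⟨g, hg, rfl⟩ := Finset.mem_image.mp hr
  have hinj : Function.Injective fun h : H => g * (h : G) := fun a b h =>
    Subtype.ext (mul_left_cancel h)
  set Fg := F.filter (c · = c g) with hFg
  let E : Finset H := Fg.preimage _ hinj.injOn
  have hEmem : ∀ h : H, h ∈ E ↔ g * (h : G) ∈ Fg := fun h => Finset.mem_preimage
  have hEF : E.image (fun h : H => g * (h : G)) = Fg := by
    ext x
    simp only [Finset.mem_image, hEmem]
    refine ⟨?_, fun hx => ?_⟩
    · rintro ⟨h, hh, rfl⟩
      exact hh
    · have hx2 : c x = c g := (Finset.mem_filter.mp hx).2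
      have : g⁻¹ * x ∈ H := QuotientGroup.eq.mp hx2.symm
      exact ⟨⟨g⁻¹ * x, this⟩, by simpa using hx, by simp⟩
  have hcard : E.card = Fg.card := by rw [← hEF, Finset.card_image_of_injective _ hinj]
  refine ⟨E, ⟨1, by rw [hEmem]; simp [hFg, hg]⟩, ?_⟩
  rw [hcard]
  refine le_trans (Finset.sum_le_sum fun s _ => ?_) hle
  rw [Nat.cast_le, ← Finset.card_image_of_injective _ hinj]
  refine Finset.card_le_card ?_
  have him : (E.image (· * s)).image (fun h : H => g * (h : G)) = Fg.image (· * (s : G)) := by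
    rw [← hEF, Finset.image_image, Finset.image_image]
    refine Finset.image_congr fun x _ => ?_
    simp [mul_assoc]
  rw [← him, ← hEF]
  convert (Finset.image_symmDiff E (E.image (· * s)) hinj).le using 2
  congr!

open Classical in
/-- In a group with Følner sets, deep enough subgroups of a separating sequence of normal
subgroups of finite index have almost invariant transversals. -/
theorem HasRightFolnerSets.eventually_exists_transversal {H : Type*} [Group H]
    (hH : HasRightFolnerSets H) (M : ℕ → Subgroup H) [∀ n, (M n).Normal] [∀ n, (M n).FiniteIndex]
    (hM : Antitone M) (hsep : ⨅ n, M n = ⊥) (S : Finset H) (ε : ℝ) (hε : 0 < ε) :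
    ∀ᶠ n in atTop, ∃ K : Finset H, Subgroup.IsComplement (K : Set H) (M n : Set H) ∧
      ∑ s ∈ S, ((K.image (s * ·) \ K).card : ℝ) ≤ ε * K.card := by
  obtain ⟨E, hE, hES⟩ := hH S ε hε
  -- Once `M n` meets `P` trivially, the quotient map identifies no element of `E` with another one
  -- of `E` or of `E s`. The entry `1` accounts for injectivity on `E`.
  let P : Finset H := (insert 1 S ×ˢ (E ×ˢ E)).image fun p => (p.2.1 * p.1)⁻¹ * p.2.2
  filter_upwards [eventually_inter_trivial M hM hsep P P.finite_toSet] with n hn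
  have key : ∀ s ∈ insert 1 S, ∀ e ∈ E, ∀ e' ∈ E, ((e' * s : H) : H ⧸ M n) = e → e' * s = e := by
    intro s hs e he e' he' h
    have := hn ((e' * s)⁻¹ * e) (Finset.mem_coe.mpr (Finset.mem_image.mpr
      ⟨(s, e', e), by simp only [Finset.mem_product]; exact ⟨hs, he', he⟩, rfl⟩))
      (QuotientGroup.eq.mp h)
    exact inv_mul_eq_one.mp this
  obtain ⟨K, hK, hle⟩ := exists_almost_invariant_transversal (M n) E S hE
    (fun e he e' he' h => by
      simpa using key 1 (Finset.mem_insert_self _ _) e he e' he' (by simpa using h))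
    (fun e he e' he' s hs h => key s (Finset.mem_insert_of_mem hs) e he e' he' h)
  refine ⟨K, hK, ?_⟩
  have hEpos : (0 : ℝ) < E.card := by exact_mod_cast hE.card_pos
  have hle' : (∑ s ∈ S, ((K.image (s * ·) \ K).card : ℝ)) * E.card ≤
      K.card * ∑ s ∈ S, ((symmDiff E (E.image (· * s))).card : ℝ) := by exact_mod_cast hle
  refine le_of_mul_le_mul_right (hle'.trans ?_) hEpos
  calc _ ≤ (K.card : ℝ) * (ε * E.card) := by gcongr
    _ = _ := by ring

end Transversals

/-! ### Nested transversals and the construction of the tilings -/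

section NestedTransversals

theorem Subgroup.IsComplement.mul_right_singleton {H : Type*} [Group H] {N : Subgroup H} [N.Normal]
    {K : Set H} (hK : Subgroup.IsComplement K (N : Set H)) (h : H) :
    Subgroup.IsComplement ((fun x => x * h) '' K) (N : Set H) := by
  rw [Subgroup.isComplement_iff_existsUnique_inv_mul_mem] at hK ⊢
  have key : ∀ k g, (k * h)⁻¹ * g ∈ (N : Set H) ↔ k⁻¹ * (g * h⁻¹) ∈ (N : Set H) := by
    intro k g
    rw [SetLike.mem_coe, SetLike.mem_coe, mul_inv_rev, mul_assoc, ‹N.Normal›.mem_comm_iff,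
      mul_assoc]
  intro g
  obtain ⟨⟨k, hk⟩, hkg, huniq⟩ := hK (g * h⁻¹)
  refine ⟨⟨k * h, k, hk, rfl⟩, (key k g).mpr hkg, ?_⟩
  rintro ⟨_, k', hk', rfl⟩ hk'g
  have := huniq ⟨k', hk'⟩ ((key k' g).mp hk'g)
  simp only [Subtype.mk.injEq] at this
  subst this
  rfl

open Classical in
/-- The number of elements of `s K` outside `K`. -/
noncomputable def leftDefect {H : Type*} [Group H] (K : Finset H) (s : H) : ℕ :=
  (K.image (s * ·) \ K).card

theorem leftDefect_eq {H : Type*} [Group H] [DecidableEq H] (K : Finset H) (s : H) :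
    leftDefect K s = (K.image (s * ·) \ K).card := by
  unfold leftDefect
  congr!

open Classical in
-- A right translate of a transversal of a normal subgroup is again one, and right translations
-- commute with left multiplication, so they preserve the defect. Translation by `k⁻¹ * g` brings
-- `g` into the set.
theorem HasRightFolnerSets.eventually_exists_transversal_mem {H : Type*} [Group H]
    (hH : HasRightFolnerSets H) (M : ℕ → Subgroup H) [∀ n, (M n).Normal] [∀ n, (M n).FiniteIndex]
    (hM : Antitone M) (hsep : ⨅ n, M n = ⊥) (S : Finset H) (ε : ℝ) (hε : 0 < ε) (g : H) :
    ∀ᶠ n in atTop, ∃ K : Finset H, Subgroup.IsComplement (K : Set H) (M n : Set H) ∧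
      (∀ s ∈ S, (leftDefect K s : ℝ) ≤ ε * K.card) ∧ g ∈ K := by
  filter_upwards [hH.eventually_exists_transversal M hM hsep S ε hε] with n ⟨K, hK, hle⟩
  obtain ⟨k, hk⟩ : K.Nonempty := Finset.coe_nonempty.mp hK.nonempty_left
  have hinj : Function.Injective fun x : H => x * (k⁻¹ * g) := mul_left_injective _
  refine ⟨K.image fun x => x * (k⁻¹ * g), ?_, fun s hs => ?_,
    Finset.mem_image.mpr ⟨k, hk, by group⟩⟩
  · rw [Finset.coe_image]
    exact hK.mul_right_singleton _
  · rw [Finset.card_image_of_injective _ hinj, leftDefect_eq]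
    refine le_trans ?_ ((Finset.single_le_sum (fun _ _ => Nat.cast_nonneg _) hs).trans hle)
    rw [Nat.cast_le, ← Finset.card_image_of_injective (K.image (s * ·) \ K) hinj]
    refine Finset.card_le_card fun x hx => ?_
    simp only [Finset.mem_sdiff, Finset.mem_image] at hx ⊢
    obtain ⟨⟨_, ⟨y, hy, rfl⟩, rfl⟩, hx⟩ := hx
    exact ⟨s * y, ⟨⟨y, hy, rfl⟩, fun h => hx ⟨s * y, h, by group⟩⟩, by group⟩

variable {G : Type u} [Group G]

theorem Subgroup.IsComplement.image_mul_subgroupOf {N M : Subgroup G} (hNM : N ≤ M) {K : Set G}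
    (hK : Subgroup.IsComplement K (M : Set G)) {T : Set M}
    (hT : Subgroup.IsComplement T (N.subgroupOf M : Set M)) :
    Subgroup.IsComplement {g | ∃ k ∈ K, ∃ t ∈ T, g = k * (t : G)} (N : Set G) := by
  rw [Subgroup.isComplement_iff_existsUnique_inv_mul_mem] at hK hT ⊢
  intro g
  obtain ⟨⟨k, hk⟩, hkg, hku⟩ := hK g
  obtain ⟨⟨t, ht⟩, htg, htu⟩ := hT ⟨k⁻¹ * g, hkg⟩
  have htg' : (t : G)⁻¹ * (k⁻¹ * g) ∈ N := htg
  refine ⟨⟨k * t, k, hk, t, ht, rfl⟩, by simpa [mul_assoc] using htg', ?_⟩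
  rintro ⟨_, k', hk', t', ht', rfl⟩ h
  have h' : (t' : G)⁻¹ * (k'⁻¹ * g) ∈ N := by simpa [mul_assoc] using h
  have e1 : k' = k := by
    have : k'⁻¹ * g ∈ (M : Set G) := by
      have := M.mul_mem t'.2 (hNM h')
      simpa using this
    simpa using hku ⟨k', hk'⟩ this
  subst e1
  have e2 : t' = t := by simpa using htu ⟨t', ht'⟩ h'
  subst e2
  rfl

open Classical in
/-- An almost invariant transversal of a deep subgroup which is a disjoint union of translates of
a given transversal. -/
theorem eventually_exists_refinement (hG : IsAmenableGroup G) (L : ℕ → Subgroup G)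
    [∀ n, (L n).Normal] [∀ n, (L n).FiniteIndex] (hL : Antitone L) (hsep : ⨅ n, L n = ⊥)
    (a : ℕ) (K : Finset G) (hK : Subgroup.IsComplement (K : Set G) (L a : Set G))
    (S : Finset G) (ε : ℝ) (hε : 0 < ε) (g : G) :
    ∀ᶠ b in atTop, ∃ K' : Finset G, Subgroup.IsComplement (K' : Set G) (L b : Set G) ∧
      (∀ s ∈ S, ((K'.image (s * ·) \ K').card : ℝ) ≤ ε * K'.card) ∧ g ∈ K' ∧
      ∃ T : Finset G, (T : Set G) ⊆ L a ∧
        (T : Set G).PairwiseDisjoint (fun t => (fun x => x * t) '' (K : Set G)) ∧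
        (K' : Set G) = ⋃ t ∈ T, (fun x => x * t) '' (K : Set G) := by
  have hKu := Subgroup.isComplement_iff_existsUnique_inv_mul_mem.mp hK
  have hex : ∀ g : G, ∃ k ∈ K, ∃ l : L a, g = k * l := by
    intro g
    obtain ⟨⟨k, hk⟩, hkg, -⟩ := hKu g
    exact ⟨k, hk, ⟨_, hkg⟩, by simp⟩
  have huniq : ∀ k ∈ K, ∀ k' ∈ K, ∀ l l' : L a, k * (l : G) = k' * l' → k = k' ∧ l = l' := by
    intro k hk k' hk' l l' h
    obtain ⟨w, -, hu⟩ := hKu (k * l)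
    have e : k = k' := by
      have e1 := hu ⟨k, hk⟩ (by simp)
      have e2 := hu ⟨k', hk'⟩ (by rw [h]; simp)
      simpa using e1.trans e2.symm
    subst e
    exact ⟨rfl, Subtype.ext (mul_left_cancel h)⟩
  choose κ hκ l hl using hex
  let M : ℕ → Subgroup (L a) := fun n => (L n).subgroupOf (L a)
  have hM : Antitone M := fun m n h => Subgroup.comap_mono (hL h)
  have hMsep : ⨅ n, M n = ⊥ := by
    rw [eq_bot_iff]
    intro x hx
    have : (x : G) ∈ ⨅ n, L n := by
      simp only [Subgroup.mem_iInf] at hx ⊢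
      exact fun n => hx n
    rw [hsep, Subgroup.mem_bot] at this
    exact Subgroup.mem_bot.mpr (Subtype.ext this)
  -- Since `s * k * t = κ (s * k) * (l (s * k) * t)`, left multiplication by `s` on `K T` acts on
  -- `T` through the finitely many elements `l (s * k)`; `T` is chosen almost invariant under these.
  filter_upwards [(hG.hasRightFolnerSets_subgroup (L a)).eventually_exists_transversal_mem M hM
    hMsep ((S ×ˢ K).image fun p => l (p.1 * p.2)) ε hε (l g), eventually_ge_atTop a]
    with b ⟨T, hT, hTS, hgT⟩ hab
  simp only [leftDefect_eq] at hTS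
  let K' : Finset G := (K ×ˢ T).image fun p => p.1 * (p.2 : G)
  have hmem : ∀ x, x ∈ K' ↔ ∃ k ∈ K, ∃ t ∈ T, x = k * (t : G) := by
    intro x
    simp only [K', Finset.mem_image, Finset.mem_product, Prod.exists]
    exact ⟨fun ⟨k, t, ⟨hk, ht⟩, h⟩ => ⟨k, hk, t, ht, h.symm⟩,
      fun ⟨k, hk, t, ht, h⟩ => ⟨k, t, ⟨hk, ht⟩, h.symm⟩⟩
  have hcard : K'.card = K.card * T.card := by
    rw [Finset.card_image_of_injOn, Finset.card_product]
    rintro ⟨k, t⟩ h1 ⟨k', t'⟩ h2 h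
    simp only [Finset.coe_product, Set.mem_prod, Finset.mem_coe] at h1 h2
    obtain ⟨e1, e2⟩ := huniq k h1.1 k' h2.1 t t' h
    rw [e1, e2]
  refine ⟨K', ?_, fun s hs => ?_, ?_, T.image (↑), ?_, ?_, ?_⟩
  · convert hK.image_mul_subgroupOf (hL hab) hT using 1
    ext x
    rw [Finset.mem_coe, hmem]
    rfl
  · have hsub : K'.image (s * ·) \ K' ⊆ K.biUnion fun k =>
        (T.image (l (s * k) * ·) \ T).image fun t : L a => κ (s * k) * (t : G) := by
      intro x hx
      simp only [Finset.mem_sdiff, Finset.mem_image, hmem, Finset.mem_biUnion] at hx ⊢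
      obtain ⟨⟨_, ⟨k, hk, t, ht, rfl⟩, rfl⟩, hx⟩ := hx
      have e : s * (k * (t : G)) = κ (s * k) * ((l (s * k) * t : L a) : G) := by
        rw [Subgroup.coe_mul, ← mul_assoc, ← mul_assoc, ← hl (s * k)]
      exact ⟨k, hk, l (s * k) * t, ⟨⟨t, ht, rfl⟩, fun h => hx ⟨_, hκ _, _, h, e⟩⟩, e.symm⟩
    calc ((K'.image (s * ·) \ K').card : ℝ)
        ≤ ∑ k ∈ K, ((T.image (l (s * k) * ·) \ T).card : ℝ) := by
          rw [← Nat.cast_sum, Nat.cast_le]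
          refine (Finset.card_le_card hsub).trans (Finset.card_biUnion_le.trans ?_)
          exact Finset.sum_le_sum fun k _ => Finset.card_image_le
      _ ≤ ∑ k ∈ K, ε * (T.card : ℝ) := by
          refine Finset.sum_le_sum fun k hk => hTS _ ?_
          exact Finset.mem_image.mpr ⟨(s, k), Finset.mem_product.mpr ⟨hs, hk⟩, rfl⟩
      _ = ε * K'.card := by
          rw [Finset.sum_const, hcard]
          push_cast
          rw [nsmul_eq_mul]
          ring
  · exact (hmem g).mpr ⟨κ g, hκ g, l g, hgT, hl g⟩
  · intro x hx
    obtain ⟨t, -, rfl⟩ := Finset.mem_image.mp hx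
    exact t.2
  · rintro _ h1 _ h2 h12
    obtain ⟨t, -, rfl⟩ := Finset.mem_image.mp h1
    obtain ⟨t', -, rfl⟩ := Finset.mem_image.mp h2
    rw [Function.onFun, Set.disjoint_left]
    rintro _ ⟨k, hk, rfl⟩ ⟨k', hk', h⟩
    exact h12 (by rw [(huniq k hk k' hk' t t' h.symm).2])
  · ext x
    simp only [Finset.mem_coe, hmem, Set.mem_iUnion, Finset.mem_image, Set.mem_image]
    constructor
    · rintro ⟨k, hk, t, ht, rfl⟩
      exact ⟨t, ⟨t, ht, rfl⟩, k, hk, rfl⟩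
    · rintro ⟨_, ⟨t, ht, rfl⟩, k, hk, rfl⟩
      exact ⟨k, hk, t, ht, rfl⟩

/-- At stage `n`, the strongest requirement `j ≤ n` that can be met is met; this `j` eventually
exceeds any given bound. -/
theorem exists_seq_eventually_of_forall_eventually_exists {α : Type*} (P : ℕ → ℕ → α → Prop)
    (hanti : ∀ i j, i ≤ j → ∀ n a, P j n a → P i n a) (h0 : ∀ n, ∃ a, P 0 n a)
    (h : ∀ j, ∀ᶠ n in atTop, ∃ a, P j n a) :
    ∃ f : ℕ → α, (∀ n, P 0 n (f n)) ∧ ∀ j, ∀ᶠ n in atTop, P j n (f n) := by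
  classical
  let m : ℕ → ℕ := fun n => Nat.findGreatest (fun j => ∃ a, P j n a) n
  have hm : ∀ n, ∃ a, P (m n) n a := fun n =>
    Nat.findGreatest_spec (P := fun j => ∃ a, P j n a) (Nat.zero_le n) (h0 n)
  choose f hf using hm
  refine ⟨f, fun n => hanti 0 _ (Nat.zero_le _) n _ (hf n), fun j => ?_⟩
  filter_upwards [h j, eventually_ge_atTop j] with n hn hjn
  exact hanti j (m n) (Nat.le_findGreatest hjn hn) n _ (hf n)

open Classical in
theorem card_symmDiff_image_mul_left (K : Finset G) (s : G) :
    (symmDiff K (K.image (s * ·))).card = 2 * (K.image (s * ·) \ K).card := by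
  have h : (K \ K.image (s * ·)).card = (K.image (s * ·) \ K).card := by
    have h1 := Finset.card_sdiff_add_card_inter K (K.image (s * ·))
    have h2 := Finset.card_sdiff_add_card_inter (K.image (s * ·)) K
    rw [Finset.card_image_of_injective _ (mul_right_injective s)] at h2
    rw [Finset.inter_comm] at h2
    omega
  rw [symmDiff_def, Finset.sup_eq_union, Finset.card_union_of_disjoint disjoint_sdiff_sdiff, h,
    two_mul]

open Classical in
theorem isLeftFolner_of_eventually (K : ℕ → Finset G)
    (h : ∀ s : G, ∀ j : ℕ, ∀ᶠ n in atTop,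
      (((K n).image (s * ·) \ K n).card : ℝ) ≤ (1 / (j + 1 : ℝ)) * (K n).card) :
    IsLeftFolner K := by
  intro s
  rw [Metric.tendsto_atTop']
  intro ε hε
  obtain ⟨j, hj⟩ := exists_nat_one_div_lt (half_pos hε)
  obtain ⟨N, hN⟩ := eventually_atTop.mp (h s j)
  refine ⟨N, fun n hn => ?_⟩
  have hn' := hN n hn.le
  rw [ncard_symmDiff_image, card_symmDiff_image_mul_left, Real.dist_eq, sub_zero,
    abs_of_nonneg (by positivity)]
  rcases (K n).card.eq_zero_or_pos with h0 | h0
  · simpa [h0] using hε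
  · have h0' : (0 : ℝ) < (K n).card := by exact_mod_cast h0
    rw [div_lt_iff₀ h0']
    push_cast
    nlinarith

open Classical in
-- Only the sets with index in the range of `ν` must be nested. Almost invariant transversals `K₀ n`
-- are chosen independently for all `n`, then replaced along `ν` by successive refinements, the
-- `j`-th of which also absorbs the `j`-th element of `G`.
theorem exists_isFolnerTiling [Countable G] (hG : IsAmenableGroup G) (L : ℕ → Subgroup G)
    [∀ n, (L n).Normal] [∀ n, (L n).FiniteIndex] (hL : Antitone L) (hsep : ⨅ n, L n = ⊥) :
    ∃ (K : ℕ → Finset G) (ν : ℕ → ℕ), IsFolnerTiling L K ν ∧ ∀ g, ∃ n, g ∈ K n := by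
  obtain ⟨e, he⟩ := exists_surjective_nat G
  let S : ℕ → Finset G := fun j => (Finset.range j).image e
  have hS : ∀ s, ∃ j, ∀ i, j ≤ i → s ∈ S i := by
    intro s
    obtain ⟨j, rfl⟩ := he s
    exact ⟨j + 1, fun i hi => Finset.mem_image.mpr ⟨j, Finset.mem_range.mpr hi, rfl⟩⟩
  let P : ℕ → ℕ → Finset G → Prop := fun j n K =>
    Subgroup.IsComplement (K : Set G) (L n : Set G) ∧
      ∀ s ∈ S j, ((K.image (s * ·) \ K).card : ℝ) ≤ (1 / (j + 1 : ℝ)) * K.card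
  have hanti : ∀ i j, i ≤ j → ∀ n K, P j n K → P i n K := by
    intro i j hij n K h
    refine ⟨h.1, fun s hs => (h.2 s ?_).trans ?_⟩
    · exact Finset.image_subset_image (Finset.range_subset_range.mpr hij) hs
    · have : (i : ℝ) ≤ j := by exact_mod_cast hij
      gcongr
  -- `S 0` is empty, so `P 0` only asks for a transversal.
  have h0 : ∀ n, ∃ K, P 0 n K := by
    intro n
    obtain ⟨K, hK, -⟩ := (L n).exists_isComplement_left 1
    refine ⟨hK.finite_left.toFinset, by simpa using hK, fun s hs => by simp [S] at hs⟩
  have href := fun (j : ℕ) (p : {p : ℕ × Finset G // P 0 p.1 p.2}) =>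
    eventually_exists_refinement hG L hL hsep p.1.1 p.1.2 p.2.1 (S j) (1 / (j + 1 : ℝ))
      (by positivity) (e j)
  obtain ⟨K₀, hK₀, hK₀'⟩ := exists_seq_eventually_of_forall_eventually_exists P hanti h0
    (fun j => by
      obtain ⟨K, hK⟩ := h0 0
      filter_upwards [href j ⟨(0, K), hK⟩] with n ⟨K', h1, h2, _⟩
      exact ⟨K', h1, h2⟩)
  have hnext : ∀ (j : ℕ) (p : {p : ℕ × Finset G // P 0 p.1 p.2}),
      ∃ q : {p : ℕ × Finset G // P 0 p.1 p.2}, p.1.1 < q.1.1 ∧ P j q.1.1 q.1.2 ∧ e j ∈ q.1.2 ∧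
        ∃ T : Finset G, (T : Set G) ⊆ L p.1.1 ∧
        (T : Set G).PairwiseDisjoint (fun t => (fun x => x * t) '' (p.1.2 : Set G)) ∧
        (q.1.2 : Set G) = ⋃ t ∈ T, (fun x => x * t) '' (p.1.2 : Set G) := by
    intro j p
    obtain ⟨b, ⟨K', h1, h2, h3, h4⟩, hb⟩ := ((href j p).and (eventually_gt_atTop p.1.1)).exists
    exact ⟨⟨(b, K'), hanti 0 j (Nat.zero_le j) b K' ⟨h1, h2⟩⟩, hb, ⟨h1, h2⟩, h3, h4⟩
  choose step hlt hP hmem href' using hnext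
  obtain ⟨q, hq⟩ : ∃ q : ℕ → {p : ℕ × Finset G // P 0 p.1 p.2}, ∀ k, q (k + 1) = step k (q k) :=
    ⟨fun k => Nat.rec ⟨(0, K₀ 0), hK₀ 0⟩ (fun j p => step j p) k, fun _ => rfl⟩
  obtain ⟨ν, hνq⟩ : ∃ ν : ℕ → ℕ, ∀ k, ν k = (q k).1.1 := ⟨_, fun _ => rfl⟩
  have hν : StrictMono ν := strictMono_nat_of_lt_succ fun k => by
    rw [hνq, hνq, hq]
    exact hlt k (q k)
  obtain ⟨K, hKν, hKn⟩ : ∃ K : ℕ → Finset G, (∀ k, K (ν k) = (q k).1.2) ∧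
      ∀ n, (¬ ∃ k, ν k = n) → K n = K₀ n := by
    refine ⟨fun n => if h : ∃ k, ν k = n then (q h.choose).1.2 else K₀ n, fun k => ?_,
      fun n h => dif_neg h⟩
    have h : ∃ k', ν k' = ν k := ⟨k, rfl⟩
    simp only [dif_pos h]
    rw [hν.injective h.choose_spec]
  have hKP : ∀ j, ∀ᶠ n in atTop, P j n (K n) := by
    intro j
    -- The set `q (i + 1)` has precision `i`, and `q 0` has none to speak of; beyond `ν (j + 1)`
    -- every nested set has precision at least `j`.
    filter_upwards [hK₀' j, eventually_gt_atTop (ν (j + 1))] with n hn hνn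
    by_cases h : ∃ k, ν k = n
    · obtain ⟨k, rfl⟩ := h
      have hk : j + 1 < k := hν.lt_iff_lt.mp hνn
      obtain ⟨i, rfl⟩ : ∃ i, k = i + 1 := ⟨k - 1, by omega⟩
      rw [hKν, hνq, hq]
      exact hanti j i (by omega) _ _ (hP i (q i))
    · rwa [hKn n h]
  refine ⟨K, ν, ⟨?_, ?_, hν, ?_⟩, ?_⟩
  · refine isLeftFolner_of_eventually K fun s j => ?_
    obtain ⟨j₀, hj₀⟩ := hS s
    filter_upwards [hKP (max j j₀)] with n hn
    refine (hn.2 s (hj₀ _ (le_max_right _ _))).trans ?_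
    have : (j : ℝ) ≤ (max j j₀ : ℕ) := by exact_mod_cast le_max_left j j₀
    gcongr
  · intro n
    by_cases h : ∃ k, ν k = n
    · obtain ⟨k, rfl⟩ := h
      rw [hKν, hνq]
      exact (q k).2.1
    · rw [hKn n h]
      exact (hK₀ n).1
  · intro k
    rw [hKν, hKν, hq, hνq]
    exact href' k (q k)
  · intro g
    obtain ⟨j, rfl⟩ := he g
    exact ⟨ν (j + 1), by rw [hKν, hq]; exact hmem j (q j)⟩

end NestedTransversals

/-! ### Characterization of the Cantor space by a binary splitting scheme -/

section CantorSpace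

variable {X : Type*} (U : ℕ → Set X)

open Classical in
/-- A member of the family `U` which splits `W` properly; the `n`-th one if possible. -/
noncomputable def splittingSet (n : ℕ) (W : Set X) : Set X :=
  if (W ∩ U n).Nonempty ∧ (W \ U n).Nonempty then U n
  else if h : ∃ m, (W ∩ U m).Nonempty ∧ (W \ U m).Nonempty then U h.choose else Set.univ

/-- The cells of the binary scheme obtained by splitting repeatedly along members of `U`. -/
noncomputable def schemeCell (b : ℕ → Bool) : ℕ → Set X
  | 0 => Set.univ
  | n + 1 => if b n then schemeCell b n ∩ splittingSet U n (schemeCell b n)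
      else schemeCell b n \ splittingSet U n (schemeCell b n)

open Classical in
/-- The cell of the `n`-th level of the scheme which contains a given point. -/
noncomputable def cellOf (x : X) : ℕ → Set X
  | 0 => Set.univ
  | n + 1 => if x ∈ splittingSet U n (cellOf x n) then cellOf x n ∩ splittingSet U n (cellOf x n)
      else cellOf x n \ splittingSet U n (cellOf x n)

open Classical in
/-- The address of a point in the scheme. -/
noncomputable def schemeAddress (x : X) (n : ℕ) : Bool :=
  decide (x ∈ splittingSet U n (cellOf U x n))

theorem schemeCell_schemeAddress (x : X) (n : ℕ) :
    schemeCell U (schemeAddress U x) n = cellOf U x n := by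
  induction n with
  | zero => rfl
  | succ n ih =>
    simp only [schemeCell, cellOf, ih]
    by_cases h : x ∈ splittingSet U n (cellOf U x n) <;> simp [schemeAddress, h]

theorem mem_schemeCell_schemeAddress (x : X) (n : ℕ) :
    x ∈ schemeCell U (schemeAddress U x) n := by
  rw [schemeCell_schemeAddress]
  induction n with
  | zero => exact Set.mem_univ x
  | succ n ih =>
    simp only [cellOf]
    split_ifs with h
    exacts [⟨ih, h⟩, ⟨ih, h⟩]

/-- Cells of one level are disjoint or equal, and a point of a cell determines the address up to
that level. Injectivity of addresses is not needed here; surjectivity and continuity of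
`schemeAddress` follow. -/
theorem schemeCell_inter {b b' : ℕ → Bool} {x : X} (n : ℕ) (h : x ∈ schemeCell U b n)
    (h' : x ∈ schemeCell U b' n) : schemeCell U b n = schemeCell U b' n ∧ ∀ i < n, b i = b' i := by
  induction n with
  | zero => exact ⟨rfl, fun i hi => absurd hi (Nat.not_lt_zero i)⟩
  | succ n ih =>
    have hx : x ∈ schemeCell U b n := by
      simp only [schemeCell] at h
      split_ifs at h
      exacts [h.1, h.1]
    have hx' : x ∈ schemeCell U b' n := by
      simp only [schemeCell] at h'
      split_ifs at h'
      exacts [h'.1, h'.1]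
    obtain ⟨e, hi⟩ := ih hx hx'
    have hn : b n = b' n := by
      simp only [schemeCell, e] at h h'
      cases hb : b n <;> cases hb' : b' n <;> simp_all
    refine ⟨by simp only [schemeCell, e, hn], fun i hlt => ?_⟩
    rcases Nat.lt_succ_iff_lt_or_eq.mp hlt with h1 | rfl
    exacts [hi i h1, hn]

variable {U} [TopologicalSpace X]

theorem isClopen_splittingSet (hU : ∀ n, IsClopen (U n)) (n : ℕ) (W : Set X) :
    IsClopen (splittingSet U n W) := by
  unfold splittingSet
  split_ifs
  exacts [hU _, hU _, isClopen_univ]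

theorem isClopen_schemeCell (hU : ∀ n, IsClopen (U n)) (b : ℕ → Bool) (n : ℕ) :
    IsClopen (schemeCell U b n) := by
  induction n with
  | zero => exact isClopen_univ
  | succ n ih =>
    simp only [schemeCell]
    split_ifs
    exacts [ih.inter (isClopen_splittingSet hU _ _), ih.diff (isClopen_splittingSet hU _ _)]

theorem schemeCell_nonempty [Nonempty X] (hU : ∀ n, IsClopen (U n))
    (hperf : ∀ V : Set X, IsOpen V → V.Nonempty →
      ∃ n, (V ∩ U n).Nonempty ∧ (V \ U n).Nonempty) (b : ℕ → Bool) (n : ℕ) :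
    (schemeCell U b n).Nonempty := by
  induction n with
  | zero => exact Set.univ_nonempty
  | succ n ih =>
    have hex := hperf _ (isClopen_schemeCell hU b n).isOpen ih
    have key : (schemeCell U b n ∩ splittingSet U n (schemeCell U b n)).Nonempty ∧
        (schemeCell U b n \ splittingSet U n (schemeCell U b n)).Nonempty := by
      -- By `hex`, the default value `Set.univ` is never taken.
      unfold splittingSet
      split_ifs with h
      exacts [h, hex.choose_spec]
    simp only [schemeCell]
    split_ifs
    exacts [key.1, key.2]

/-- A compact Hausdorff space without isolated points in which the points are separated by
countably many clopen sets is homeomorphic to the Cantor space. -/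
theorem nonempty_homeomorph_nat_bool [CompactSpace X] [Nonempty X]
    (hU : ∀ n, IsClopen (U n)) (hsep : ∀ x y, (∀ n, x ∈ U n ↔ y ∈ U n) → x = y)
    (hperf : ∀ V : Set X, IsOpen V → V.Nonempty →
      ∃ n, (V ∩ U n).Nonempty ∧ (V \ U n).Nonempty) : Nonempty (X ≃ₜ (ℕ → Bool)) := by
  have hinj : Function.Injective (schemeAddress U) := by
    intro x y hxy
    refine hsep x y fun n => ?_
    have hx := mem_schemeCell_schemeAddress U x
    have hy := mem_schemeCell_schemeAddress U y
    rw [← hxy] at hy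
    set W := schemeCell U (schemeAddress U x) n with hW
    -- If `U n` splits the common cell `W`, it is the set used at level `n`, and the equal addresses
    -- put both points on the same side. If it does not, `W` lies on one side of it.
    by_cases h : (W ∩ U n).Nonempty ∧ (W \ U n).Nonempty
    · have hs : splittingSet U n W = U n := if_pos h
      have hx' := hx (n + 1)
      have hy' := hy (n + 1)
      simp only [schemeCell, ← hW, hs] at hx' hy'
      split_ifs at hx' hy'
      · exact ⟨fun _ => hy'.2, fun _ => hx'.2⟩
      · exact ⟨fun h => absurd h hx'.2, fun h => absurd h hy'.2⟩
    · constructor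
      · intro hxn
        by_contra hyn
        exact h ⟨⟨x, hx n, hxn⟩, ⟨y, hy n, hyn⟩⟩
      · intro hyn
        by_contra hxn
        exact h ⟨⟨y, hy n, hyn⟩, ⟨x, hx n, hxn⟩⟩
  have hsurj : Function.Surjective (schemeAddress U) := by
    intro b
    obtain ⟨x, hx⟩ := IsCompact.nonempty_iInter_of_sequence_nonempty_isCompact_isClosed
      (schemeCell U b) (fun n => by
        simp only [schemeCell]
        split_ifs
        exacts [Set.inter_subset_left, Set.sdiff_subset])
      (schemeCell_nonempty hU hperf b) isCompact_univ (fun n => (isClopen_schemeCell hU b n).isClosed)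
    rw [Set.mem_iInter] at hx
    exact ⟨x, funext fun n => (schemeCell_inter U (n + 1) (mem_schemeCell_schemeAddress U x _)
      (hx (n + 1))).2 n (Nat.lt_succ_self n)⟩
  have hcont : Continuous (schemeAddress U) := by
    refine continuous_pi fun n => ?_
    refine IsLocallyConstant.continuous ((IsLocallyConstant.iff_eventually_eq _).mpr fun x => ?_)
    filter_upwards [(isClopen_schemeCell hU (schemeAddress U x) (n + 1)).isOpen.mem_nhds
      (mem_schemeCell_schemeAddress U x (n + 1))] with y hy
    exact (schemeCell_inter U (n + 1) (mem_schemeCell_schemeAddress U y _) hy).2 n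
      (Nat.lt_succ_self n)
  exact ⟨Continuous.homeoOfEquivCompactToT2 (f := Equiv.ofBijective _ ⟨hinj, hsurj⟩) hcont⟩

end CantorSpace

/-! ### The profinite completion as a Cantor space with a free action -/

section Completion

variable {G : Type u} [Group G] {L : ℕ → Subgroup G} [∀ n, (L n).Normal] {hL : Antitone L}

@[simp]
theorem completion_smul_apply (g : G) (x : profiniteCompletion L hL) (n : ℕ) :
    (g • x).1 n = (g : G ⧸ L n) * x.1 n :=
  rfl

theorem completion_apply_eq_of_le {x y : profiniteCompletion L hL} {m n : ℕ} (h : m ≤ n)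
    (hxy : x.1 n = y.1 n) : x.1 m = y.1 m := by
  rw [← x.2 m n h, ← y.2 m n h, hxy]

theorem completion_smul_eq_smul (hsep : ⨅ n, L n = ⊥) {x : profiniteCompletion L hL} {g h : G}
    (e : g • x = h • x) : g = h := by
  have key : h⁻¹ * g ∈ ⨅ n, L n := by
    refine Subgroup.mem_iInf.mpr fun n => ?_
    have := congrArg (fun y => y.1 n) e
    simp only [completion_smul_apply, mul_left_inj] at this
    exact QuotientGroup.eq.mp this.symm
  rw [hsep, Subgroup.mem_bot] at key
  exact (inv_mul_eq_one.mp key).symm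

theorem exists_ne_one_mem_of_finiteIndex [Infinite G] (N : Subgroup G) [N.FiniteIndex] :
    ∃ g ∈ N, g ≠ 1 := by
  by_contra! h
  have hbot : N = ⊥ := (Subgroup.eq_bot_iff_forall N).mpr h
  have : (⊥ : Subgroup G).FiniteIndex := hbot ▸ ‹N.FiniteIndex›
  have : Finite (G ⧸ (⊥ : Subgroup G)) := Subgroup.finite_quotient_of_finiteIndex
  exact not_finite_iff_infinite.mpr ‹Infinite G›
    (Finite.of_equiv _ (QuotientGroup.quotientBot (G := G)).toEquiv)

variable [TopologicalSpace G]

theorem continuous_completion_apply (n : ℕ) :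
    Continuous fun x : profiniteCompletion L hL => x.1 n :=
  (continuous_apply n).comp continuous_subtype_val

/-- A basic neighbourhood restricts finitely many coordinates, and all of these are determined by
any deeper one. -/
theorem eventually_cylinder_subset {x : profiniteCompletion L hL}
    {V : Set (profiniteCompletion L hL)} (hV : V ∈ 𝓝 x) :
    ∀ᶠ n in atTop, ∀ y : profiniteCompletion L hL, y.1 n = x.1 n → y ∈ V := by
  rw [nhds_subtype_eq_comap, mem_comap] at hV
  obtain ⟨t, ht, htV⟩ := hV
  rw [nhds_pi, Filter.mem_pi] at ht
  obtain ⟨I, hI, s, hs, hst⟩ := ht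
  obtain ⟨N, hN⟩ := hI.bddAbove
  filter_upwards [eventually_ge_atTop N] with n hn y hy
  refine htV (hst fun i hi => ?_)
  rw [completion_apply_eq_of_le ((hN hi).trans hn) hy]
  exact mem_of_mem_nhds (hs i)

variable [DiscreteTopology G]

instance completion_discreteTopology_quotient (n : ℕ) : DiscreteTopology (G ⧸ L n) :=
  QuotientGroup.discreteTopology (isOpen_discrete _)

theorem isClopen_cylinder (n : ℕ) (c : G ⧸ L n) :
    IsClopen {x : profiniteCompletion L hL | x.1 n = c} :=
  (isClopen_discrete {c}).preimage (continuous_completion_apply n)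

instance completion_continuousConstSMul : ContinuousConstSMul G (profiniteCompletion L hL) where
  continuous_const_smul g := by
    refine Continuous.subtype_mk (continuous_pi fun n => ?_) _
    exact (continuous_of_discreteTopology (f := fun c : G ⧸ L n => (g : G ⧸ L n) * c)).comp
      (continuous_completion_apply n)

variable [∀ n, (L n).FiniteIndex]

instance completion_compactSpace : CompactSpace (profiniteCompletion L hL) := by
  refine isCompact_iff_compactSpace.mp (IsClosed.isCompact ?_)
  have : ((profiniteCompletion L hL : Subgroup (∀ n, G ⧸ L n)) : Set (∀ n, G ⧸ L n)) =
      ⋂ n, ⋂ m, ⋂ h : n ≤ m,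
        {x | QuotientGroup.map (L m) (L n) (MonoidHom.id G) (hL h) (x m) = x n} := by
    ext x
    simp only [Set.mem_iInter]
    rfl
  rw [this]
  refine isClosed_iInter fun n => isClosed_iInter fun m => isClosed_iInter fun h => ?_
  exact isClosed_eq (continuous_of_discreteTopology.comp (continuous_apply m)) (continuous_apply n)

instance completion_secondCountableTopology :
    SecondCountableTopology (profiniteCompletion L hL) := by
  have : SecondCountableTopology (∀ n, G ⧸ L n) := inferInstance
  exact TopologicalSpace.Subtype.secondCountableTopology _

theorem completion_homeomorph_cantorSet [Infinite G] (hsep : ⨅ n, L n = ⊥) :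
    Nonempty (profiniteCompletion L hL ≃ₜ cantorSet) := by
  have : Countable (Σ n, G ⧸ L n) := inferInstance
  have hne : Nonempty (Σ n, G ⧸ L n) := ⟨⟨0, 1⟩⟩
  obtain ⟨e, he⟩ := exists_surjective_nat (Σ n, G ⧸ L n)
  let C : (Σ n, G ⧸ L n) → Set (profiniteCompletion L hL) := fun σ => {x | x.1 σ.1 = σ.2}
  obtain ⟨φ⟩ := nonempty_homeomorph_nat_bool (X := profiniteCompletion L hL)
    (U := fun k => C (e k)) (fun k => isClopen_cylinder _ _) (by
      intro x y h
      refine Subtype.ext (funext fun n => ?_)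
      obtain ⟨k, hk⟩ := he ⟨n, x.1 n⟩
      have := h k
      rw [hk] at this
      exact (this.mp rfl).symm) (by
      rintro V hV ⟨x, hx⟩
      obtain ⟨n, hn⟩ := (eventually_cylinder_subset (hV.mem_nhds hx)).exists
      -- A nontrivial element of `L n` moves `x` by freeness but keeps it in its cylinder of level
      -- `n`, so `x` is not isolated.
      obtain ⟨g, hg, hg1⟩ := exists_ne_one_mem_of_finiteIndex (L n)
      have hgV : g • x ∈ V := hn _ (by
        rw [completion_smul_apply, (QuotientGroup.eq_one_iff g).mpr hg, one_mul])
      have hne : g • x ≠ x := fun h => hg1 (completion_smul_eq_smul hsep (h.trans (one_smul G x).symm))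
      obtain ⟨m, hm⟩ : ∃ m, (g • x).1 m ≠ x.1 m := by
        by_contra! h
        exact hne (Subtype.ext (funext h))
      obtain ⟨k, hk⟩ := he ⟨m, x.1 m⟩
      refine ⟨k, ⟨x, hx, ?_⟩, ⟨g • x, hgV, ?_⟩⟩
      · rw [hk]
        exact rfl
      · rw [hk]
        exact hm)
  exact ⟨φ.trans cantorSetHomeomorphNatToBool.symm⟩

end Completion

/-! ### Transformation groupoids of discrete groups -/

section TransformationGroupoid

theorem isLocalHomeomorph_fst_of_discreteTopology {X Y : Type*} [TopologicalSpace X]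
    [TopologicalSpace Y] [DiscreteTopology Y] : IsLocalHomeomorph (Prod.fst : X × Y → X) := by
  refine isLocalHomeomorph_iff_isOpenEmbedding_restrict.mpr fun p => ?_
  have hopen : IsOpen (Set.univ ×ˢ {p.2} : Set (X × Y)) := isOpen_univ.prod (isOpen_discrete _)
  refine ⟨_, hopen.mem_nhds ⟨Set.mem_univ _, rfl⟩,
    IsOpenEmbedding.of_continuous_injective_isOpenMap (continuous_fst.comp continuous_subtype_val) ?_
      (isOpenMap_fst.comp hopen.isOpenMap_subtype_val)⟩
  rintro ⟨⟨x, g⟩, _, hg⟩ ⟨⟨y, h⟩, _, hh⟩ e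
  exact Subtype.ext (Prod.ext e (hg.trans hh.symm))

variable {X G : Type u} [Group G] [MulAction G X]

@[simp]
theorem transformationGroupoid_mul (p q : X × G) :
    (transformationGroupoid X G).mul p q = (p.1, q.2 * p.2) :=
  rfl

@[simp]
theorem transformationGroupoid_inv (p : X × G) :
    (transformationGroupoid X G).inv p = (p.2 • p.1, p.2⁻¹) :=
  rfl

@[simp]
theorem transformationGroupoid_src (p : X × G) : (transformationGroupoid X G).src p = (p.1, 1) := by
  simp [ArrowGroupoid.src]

@[simp]
theorem transformationGroupoid_rng (p : X × G) :
    (transformationGroupoid X G).rng p = (p.2 • p.1, 1) := by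
  simp [ArrowGroupoid.rng]

theorem transformationGroupoid_comp (p q : X × G) :
    (transformationGroupoid X G).Comp p q ↔ p.2 • p.1 = q.1 := by
  simp [ArrowGroupoid.Comp]

theorem transformationGroupoid_units :
    (transformationGroupoid X G).units = Set.range fun x : X => (x, (1 : G)) := by
  ext p
  constructor
  · rintro ⟨q, rfl⟩
    exact ⟨q.1, by simp⟩
  · rintro ⟨x, rfl⟩
    exact ⟨(x, 1), by simp⟩

variable [TopologicalSpace X] [TopologicalSpace G] [DiscreteTopology G]

/-- The unit space of a transformation groupoid is the space acted upon. -/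
def transformationGroupoidUnits : (transformationGroupoid X G).units ≃ₜ X where
  toFun u := u.1.1
  invFun x := ⟨(x, 1), by rw [transformationGroupoid_units]; exact ⟨x, rfl⟩⟩
  left_inv := by
    rintro ⟨p, hp⟩
    rw [transformationGroupoid_units] at hp
    obtain ⟨x, rfl⟩ := hp
    rfl
  right_inv _ := rfl
  continuous_toFun := continuous_fst.comp continuous_subtype_val
  continuous_invFun := by fun_prop

theorem isCantor_transformationGroupoid [ContinuousConstSMul G X] [Countable G] [T2Space X]
    [CompactSpace X] [SecondCountableTopology X] (hX : Nonempty (X ≃ₜ cantorSet)) :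
    (transformationGroupoid X G).IsCantor where
  secondCountable := inferInstance
  locallyCompact := inferInstance
  hausdorff := inferInstance
  continuous_inv := by
    refine continuous_prod_of_discrete_right.mpr fun g => ?_
    have : Continuous fun x : X => (g • x, g⁻¹) := (continuous_const_smul g).prodMk continuous_const
    exact this
  continuousOn_mul := by
    refine Continuous.continuousOn ?_
    simp only [transformationGroupoid_mul]
    exact (continuous_fst.comp continuous_fst).prodMk
      ((continuous_of_discreteTopology (f := fun p : G × G => p.2 * p.1)).comp
        ((continuous_snd.comp continuous_fst).prodMk (continuous_snd.comp continuous_snd)))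
  etale := by
    -- After identifying the unit space with `X`, the source map is the first projection of `X × G`.
    refine IsLocalHomeomorph.of_comp (g := transformationGroupoidUnits) ?_
      transformationGroupoidUnits.isLocalHomeomorph ?_
    · convert (isLocalHomeomorph_fst_of_discreteTopology : IsLocalHomeomorph (Prod.fst : X × G → X))
      ext p
      have : ((transformationGroupoid X G).src p).1 = p.1 := by rw [transformationGroupoid_src]
      exact this
    · refine Continuous.subtype_mk ?_ _
      have : (transformationGroupoid X G).src = fun p => (p.1, 1) :=
        funext transformationGroupoid_src
      rw [this]
      fun_prop
  units_cantor := hX.map fun e => transformationGroupoidUnits.trans e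

end TransformationGroupoid

/-! ### The tile subgroupoids and the large AF subgroupoid -/

section Tiles

/-- An embedding of `Fin m × B` into `K` supplies the room for `m` graphs with disjoint ranges. The
value of `θ i` outside `B` is immaterial. -/
theorem Finset.exists_disjoint_injections {α : Type*} (B K : Finset α) (m : ℕ)
    (h : m * B.card ≤ K.card) : ∃ θ : Fin m → α → α, (∀ i, ∀ b ∈ B, θ i b ∈ K) ∧
      ∀ i j, ∀ b ∈ B, ∀ b' ∈ B, θ i b = θ j b' → i = j ∧ b = b' := by
  classical
  obtain ⟨f⟩ := Function.Embedding.nonempty_of_card_le (α := Fin m × B) (β := K) (by simpa using h)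
  refine ⟨fun i b => if hb : b ∈ B then f (i, ⟨b, hb⟩) else b, fun i b hb => ?_,
    fun i j b hb b' hb' e => ?_⟩
  · simp only [dif_pos hb]
    exact (f _).2
  · simp only [dif_pos hb, dif_pos hb'] at e
    simpa using f.injective (Subtype.ext e)

open Classical in
/-- The part of a Følner set which is moved out of it by some element of a given finite set is
small. -/
theorem IsFolnerTiling.exists_mul_card_le {G : Type u} [Group G] {L : ℕ → Subgroup G}
    {K : ℕ → Finset G} {ν : ℕ → ℕ} (h : IsFolnerTiling L K ν) (F : Finset G) (m : ℕ) :
    ∃ k, m * ((K (ν k)).filter fun b => ∃ s ∈ F, s * b ∉ K (ν k)).card ≤ (K (ν k)).card := by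
  have hlim : Tendsto (fun k => ∑ s ∈ F, ((symmDiff (K (ν k)) ((K (ν k)).image (s * ·))).card : ℝ) /
      (K (ν k)).card) atTop (𝓝 0) := by
    rw [← Finset.sum_const_zero (s := F)]
    refine tendsto_finsetSum _ fun s _ => ?_
    have := (h.leftFolner s).comp h.strictMono.tendsto_atTop
    simpa only [Function.comp_def, ncard_symmDiff_image] using this
  -- The threshold `1 / (m + 1)` also makes sense for `m = 0`.
  obtain ⟨k, hk⟩ := (hlim.eventually (gt_mem_nhds (by positivity : (0 : ℝ) < 1 / (m + 1)))).exists
  refine ⟨k, ?_⟩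
  have hpos : (0 : ℝ) < (K (ν k)).card := by
    have := Finset.card_pos.mpr (Finset.coe_nonempty.mp (h.tiling (ν k)).nonempty_left)
    exact_mod_cast this
  rw [← Finset.sum_div, div_lt_iff₀ hpos] at hk
  have hle : ((K (ν k)).filter fun b => ∃ s ∈ F, s * b ∉ K (ν k)).card ≤
      ∑ s ∈ F, (symmDiff (K (ν k)) ((K (ν k)).image (s * ·))).card := by
    calc _ ≤ (F.biUnion fun s => (K (ν k)).filter fun b => s * b ∉ K (ν k)).card := by
          refine Finset.card_le_card fun b hb => ?_
          simp only [Finset.mem_filter, Finset.mem_biUnion] at hb ⊢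
          obtain ⟨hb, s, hs, hsb⟩ := hb
          exact ⟨s, hs, hb, hsb⟩
      _ ≤ ∑ s ∈ F, ((K (ν k)).filter fun b => s * b ∉ K (ν k)).card := Finset.card_biUnion_le
      _ ≤ _ := by
          refine Finset.sum_le_sum fun s _ => ?_
          refine Finset.card_le_card_of_injOn (fun b => s * b) ?_ (mul_right_injective s).injOn
          intro b hb
          simp only [Finset.coe_filter, Set.mem_ofPred_eq] at hb
          rw [Finset.mem_coe, Finset.mem_symmDiff]
          exact Or.inr ⟨Finset.mem_image_of_mem _ hb.1, hb.2⟩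
  have hle' : (((K (ν k)).filter fun b => ∃ s ∈ F, s * b ∉ K (ν k)).card : ℝ) ≤
      ∑ s ∈ F, ((symmDiff (K (ν k)) ((K (ν k)).image (s * ·))).card : ℝ) := by exact_mod_cast hle
  have h1 := hle'.trans hk.le
  rw [one_div, inv_mul_eq_div, le_div_iff₀ (by positivity)] at h1
  have h2 : (m : ℝ) * ((K (ν k)).filter fun b => ∃ s ∈ F, s * b ∉ K (ν k)).card ≤
      (K (ν k)).card := by
    refine le_trans ?_ h1
    rw [mul_comm]
    gcongr
    linarith
  exact_mod_cast h2

variable {G : Type u} [Group G] {L : ℕ → Subgroup G} [∀ n, (L n).Normal] {hL : Antitone L}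
  {K : ℕ → Finset G} {ν : ℕ → ℕ}

theorem Subgroup.IsComplement.eq_of_mk_eq {N : Subgroup G} {S : Set G}
    (h : Subgroup.IsComplement S (N : Set G)) {g g' : G} (hg : g ∈ S) (hg' : g' ∈ S)
    (e : (g : G ⧸ N) = g') : g = g' := by
  have := (Subgroup.isComplement_subgroup_right_iff_existsUnique_quotientGroupMk.mp h
    (g' : G ⧸ N)).unique (y₁ := ⟨g, hg⟩) (y₂ := ⟨g', hg'⟩) e rfl
  simpa using this

theorem Subgroup.IsComplement.exists_mk_eq {N : Subgroup G} {S : Set G}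
    (h : Subgroup.IsComplement S (N : Set G)) (q : G ⧸ N) : ∃ g ∈ S, (g : G ⧸ N) = q := by
  obtain ⟨⟨g, hg⟩, e, -⟩ :=
    Subgroup.isComplement_subgroup_right_iff_existsUnique_quotientGroupMk.mp h q
  exact ⟨g, hg, e⟩

/-- For a tiling, `g` is the unique position of the source in `K n`; the arrow belongs to the
subgroupoid when it keeps this position inside `K n`. -/
theorem mem_tileSubgroupoid {n : ℕ} {p : profiniteCompletion L hL × G} :
    p ∈ tileSubgroupoid L hL K n ↔ ∃ g ∈ K n, (g : G ⧸ L n) = p.1.1 n ∧ p.2 * g ∈ K n := by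
  constructor
  · rintro ⟨x, hx, g, hg, g₁, hg₁, rfl⟩
    exact ⟨g, hg, by simp [hx], by simpa using hg₁⟩
  · rintro ⟨g, hg, e, h⟩
    refine ⟨g⁻¹ • p.1, ?_, g, hg, p.2 * g, h, ?_⟩
    · simp [← e]
    · simp

theorem mk_eq_completion_apply_of_le {x : profiniteCompletion L hL} {g : G} {m n : ℕ} (h : m ≤ n)
    (e : (g : G ⧸ L n) = x.1 n) : (g : G ⧸ L m) = x.1 m := by
  rw [← x.2 m n h, ← e]
  rfl

theorem isWideSubgroupoid_tileSubgroupoid {n : ℕ}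
    (hK : Subgroup.IsComplement (K n : Set G) (L n : Set G)) :
    (completionGroupoid L hL).IsWideSubgroupoid (tileSubgroupoid L hL K n) where
  mul_mem := by
    intro p hp q hq hpq
    rw [transformationGroupoid_comp] at hpq
    rw [mem_tileSubgroupoid] at hp hq ⊢
    obtain ⟨g, hg, e, h⟩ := hp
    obtain ⟨g', hg', e', h'⟩ := hq
    have : p.2 * g = g' := by
      refine hK.eq_of_mk_eq h hg' ?_
      rw [e', ← hpq, completion_smul_apply, QuotientGroup.mk_mul, e]
    refine ⟨g, hg, e, ?_⟩
    rw [transformationGroupoid_mul]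
    simpa [mul_assoc, this] using h'
  inv_mem := by
    intro p hp
    rw [mem_tileSubgroupoid] at hp ⊢
    obtain ⟨g, hg, e, h⟩ := hp
    refine ⟨p.2 * g, h, ?_, ?_⟩
    · rw [QuotientGroup.mk_mul, e]
      rfl
    · simpa using hg
  units_subset := by
    rw [transformationGroupoid_units]
    rintro _ ⟨x, rfl⟩
    rw [mem_tileSubgroupoid]
    obtain ⟨g, hg, e⟩ := hK.exists_mk_eq (x.1 n)
    exact ⟨g, hg, e, by simpa using hg⟩

theorem isPrincipalOn_completionGroupoid (hsep : ⨅ n, L n = ⊥)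
    (H : Set (profiniteCompletion L hL × G)) : (completionGroupoid L hL).IsPrincipalOn H := by
  rintro ⟨x, g⟩ - ⟨y, h⟩ - e₁ e₂
  simp only [transformationGroupoid_src, transformationGroupoid_rng, Prod.mk.injEq, and_true]
    at e₁ e₂
  subst e₁
  rw [completion_smul_eq_smul hsep e₂]

/-- The position at level `ν (k + 1)` has the form `c * t` with `t ∈ L (ν k)`, so `c` is the
position at level `ν k`. An arrow keeping `c` in `K (ν k)` keeps `c * t` in the same translate `K (ν
k) t`. -/
theorem IsFolnerTiling.monotone_tileSubgroupoid (h : IsFolnerTiling L K ν) :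
    Monotone fun k => tileSubgroupoid L hL K (ν k) := by
  refine monotone_nat_of_le_succ fun k p hp => ?_
  rw [mem_tileSubgroupoid] at hp ⊢
  obtain ⟨g, hg, e, hp⟩ := hp
  obtain ⟨T, hTL, -, hT⟩ := h.refine k
  obtain ⟨g', hg', e'⟩ := (h.tiling (ν (k + 1))).exists_mk_eq (p.1.1 (ν (k + 1)))
  have hg'' := hg'
  rw [hT] at hg''
  simp only [Set.mem_iUnion, Set.mem_image, Finset.mem_coe] at hg''
  obtain ⟨t, ht, c, hc, rfl⟩ := hg''
  have hcg : c = g := by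
    refine (h.tiling (ν k)).eq_of_mk_eq hc hg ?_
    rw [e, ← mk_eq_completion_apply_of_le (h.strictMono (Nat.lt_succ_self k)).le e',
      QuotientGroup.mk_mul_of_mem c (hTL ht)]
  subst hcg
  refine ⟨c * t, hg', e', ?_⟩
  rw [← Finset.mem_coe, hT, ← mul_assoc]
  simp only [Set.mem_iUnion, Set.mem_image, Finset.mem_coe]
  exact ⟨t, ht, p.2 * c, hp, rfl⟩

variable [TopologicalSpace G] [DiscreteTopology G]

theorem isCompact_isOpen_tileSubgroupoid [∀ n, (L n).FiniteIndex] (n : ℕ) :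
    IsCompact (tileSubgroupoid L hL K n) ∧ IsOpen (tileSubgroupoid L hL K n) := by
  have : tileSubgroupoid L hL K n = ⋃ g ∈ K n, ⋃ g₁ ∈ K n,
      {x : profiniteCompletion L hL | x.1 n = g} ×ˢ {g₁ * g⁻¹} := by
    ext p
    simp only [mem_tileSubgroupoid, Set.mem_iUnion, Set.mem_prod, Set.mem_singleton_iff,
      exists_prop]
    constructor
    · rintro ⟨g, hg, e, h⟩
      exact ⟨g, hg, p.2 * g, h, e.symm, by simp⟩
    · rintro ⟨g, hg, g₁, hg₁, e, h⟩
      exact ⟨g, hg, Eq.symm e, by simpa [h] using hg₁⟩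
  rw [this]
  constructor
  · refine (K n).finite_toSet.isCompact_biUnion fun g _ =>
      (K n).finite_toSet.isCompact_biUnion fun g₁ _ => ?_
    exact (isClopen_cylinder n _).isClosed.isCompact.prod isCompact_singleton
  · refine isOpen_biUnion fun g _ => isOpen_biUnion fun g₁ _ => ?_
    exact (isClopen_cylinder n _).isOpen.prod (isOpen_discrete _)

theorem IsFolnerTiling.isLargeAFSubgroupoid [∀ n, (L n).FiniteIndex] (hsep : ⨅ n, L n = ⊥)
    (h : IsFolnerTiling L K ν) :
    (completionGroupoid L hL).IsLargeAFSubgroupoid (⋃ k, tileSubgroupoid L hL K (ν k)) where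
  wide :=
    { mul_mem := by
        intro p hp q hq hpq
        obtain ⟨i, hi⟩ := Set.mem_iUnion.mp hp
        obtain ⟨j, hj⟩ := Set.mem_iUnion.mp hq
        exact Set.mem_iUnion.mpr ⟨max i j, (isWideSubgroupoid_tileSubgroupoid (h.tiling _)).mul_mem
          _ (h.monotone_tileSubgroupoid (le_max_left i j) hi)
          _ (h.monotone_tileSubgroupoid (le_max_right i j) hj) hpq⟩
      inv_mem := by
        intro p hp
        obtain ⟨i, hi⟩ := Set.mem_iUnion.mp hp
        exact Set.mem_iUnion.mpr ⟨i, (isWideSubgroupoid_tileSubgroupoid (h.tiling _)).inv_mem _ hi⟩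
      units_subset := ((isWideSubgroupoid_tileSubgroupoid (h.tiling _)).units_subset).trans
        (Set.subset_iUnion (fun k => tileSubgroupoid L hL K (ν k)) 0) }
  isOpen := isOpen_iUnion fun k => (isCompact_isOpen_tileSubgroupoid (ν k)).2
  isAF := ⟨fun k => tileSubgroupoid L hL K (ν k), h.monotone_tileSubgroupoid, fun k =>
    ⟨isWideSubgroupoid_tileSubgroupoid (h.tiling _), (isCompact_isOpen_tileSubgroupoid (ν k)).1,
      (isCompact_isOpen_tileSubgroupoid (ν k)).2, isPrincipalOn_completionGroupoid hsep _⟩, rfl⟩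
  graphs := by
    classical
    intro C hC hCH m _
    have hfin : (Prod.snd '' C).Finite := isCompact_iff_finite.mp (hC.image continuous_snd)
    obtain ⟨k, hk⟩ := h.exists_mul_card_le hfin.toFinset m
    set n := ν k
    choose f hfK hf using fun q => (h.tiling n).exists_mk_eq q
    -- `B` is the boundary of `K n` for the group elements occurring in `C`: a source in `C` with
    -- position outside `B` would give an arrow of the subgroupoid.
    set B := (K n).filter fun b => ∃ s ∈ hfin.toFinset, s * b ∉ K n with hB
    have hCB : ∀ p ∈ C, f (p.1.1 n) ∈ B := by
      intro p hp
      refine Finset.mem_filter.mpr ⟨hfK _, p.2, hfin.mem_toFinset.mpr ⟨p, hp, rfl⟩, fun hcon => ?_⟩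
      exact hCH hp (Set.mem_iUnion.mpr ⟨k, mem_tileSubgroupoid.mpr ⟨_, hfK _, hf _, hcon⟩⟩)
    obtain ⟨θ, hθK, hθ⟩ := Finset.exists_disjoint_injections B (K n) m hk
    -- The `i`-th graph moves a point from its position `b` to the position `θ i b`.
    let D : Fin m → profiniteCompletion L hL → profiniteCompletion L hL × G := fun i y =>
      (y, θ i (f (y.1 n)) * (f (y.1 n))⁻¹)
    have hD : ∀ i, Continuous (D i) := fun i => continuous_id.prodMk
      ((continuous_of_discreteTopology (f := fun q => θ i (f q) * (f q)⁻¹)).comp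
        (continuous_completion_apply n))
    have hmk : ∀ i (y : profiniteCompletion L hL), ((D i y).2 • y).1 n = θ i (f (y.1 n)) := by
      intro i y
      rw [completion_smul_apply]
      simp only [D, QuotientGroup.mk_mul, QuotientGroup.mk_inv]
      rw [hf]
      simp
    -- The endpoint reveals its position, hence `i` and `b`, hence the group element that was
    -- applied.
    have key : ∀ i j, ∀ p ∈ C, ∀ q ∈ C, (D i p.1).2 • p.1 = (D j q.1).2 • q.1 →
        i = j ∧ p.1 = q.1 := by
      intro i j p hp q hq e
      have e1 := congrArg (fun y => y.1 n) e
      simp only [hmk] at e1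
      obtain ⟨hij, hb⟩ := hθ i j _ (hCB p hp) _ (hCB q hq)
        ((h.tiling n).eq_of_mk_eq (hθK i _ (hCB p hp)) (hθK j _ (hCB q hq)) e1)
      subst hij
      refine ⟨rfl, ?_⟩
      simp only [D, hb] at e
      exact smul_left_cancel _ e
    refine ⟨fun i => D i '' (Prod.fst '' C), fun i => ⟨(hC.image continuous_fst).image (hD i),
      ?_, ⟨?_, ?_⟩, ?_⟩, ?_⟩
    · rintro _ ⟨_, ⟨p, hp, rfl⟩, rfl⟩
      refine Set.mem_iUnion.mpr ⟨k, mem_tileSubgroupoid.mpr ⟨f (p.1.1 n), hfK _, hf _, ?_⟩⟩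
      simpa [D] using hθK i _ (hCB p hp)
    · rintro _ ⟨y, -, rfl⟩ _ ⟨z, -, rfl⟩ e
      simp only [transformationGroupoid_src, Prod.mk.injEq, and_true] at e
      have e' : y = z := e
      rw [e']
    · rintro _ ⟨_, ⟨p, hp, rfl⟩, rfl⟩ _ ⟨_, ⟨q, hq, rfl⟩, rfl⟩ e
      simp only [transformationGroupoid_rng, Prod.mk.injEq, and_true] at e
      rw [(key i i p hp q hq e).2]
    · ext u
      simp only [Set.mem_image, transformationGroupoid_src]
      constructor
      · rintro ⟨_, ⟨_, ⟨p, hp, rfl⟩, rfl⟩, rfl⟩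
        exact ⟨p, hp, rfl⟩
      · rintro ⟨p, hp, rfl⟩
        exact ⟨_, ⟨_, ⟨p, hp, rfl⟩, rfl⟩, rfl⟩
    · intro i j hij
      refine Set.disjoint_left.mpr ?_
      rintro _ ⟨_, ⟨_, ⟨p, hp, rfl⟩, rfl⟩, rfl⟩ ⟨_, ⟨_, ⟨q, hq, rfl⟩, rfl⟩, e⟩
      simp only [transformationGroupoid_rng, Prod.mk.injEq, and_true] at e
      exact hij (key j i q hq p hp e).1.symm

end Tiles

/-! ### Projections close to a closed ideal -/

section Ideals

/-- Modulo `I`, every power of `q - e` equals `q`, while the powers tend to `0`. Here `y j` is the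
power with exponent `j + 1`. -/
theorem TwoSidedIdeal.mem_of_norm_sub_lt_one {R : Type*} [NonUnitalNormedRing R]
    (I : TwoSidedIdeal R) (hI : IsClosed {a | a ∈ I}) {q e : R} (hq : q * q = q) (he : e ∈ I)
    (h : ‖q - e‖ < 1) : q ∈ I := by
  let y : ℕ → R := fun j => Nat.rec (q - e) (fun _ z => (q - e) * z) j
  have hy : ∀ j, ‖y j‖ ≤ ‖q - e‖ ^ (j + 1) := by
    intro j
    induction j with
    | zero => simp [y]
    | succ j ih =>
      calc ‖(q - e) * y j‖ ≤ ‖q - e‖ * ‖y j‖ := norm_mul_le _ _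
        _ ≤ ‖q - e‖ * ‖q - e‖ ^ (j + 1) := by gcongr
        _ = _ := by ring
  have hmem : ∀ j, q - y j ∈ I := by
    intro j
    induction j with
    | zero => simpa [y] using he
    | succ j ih =>
      have e1 : q - y (j + 1) = e * q + (q - e) * (q - y j) := by
        change q - (q - e) * y j = _
        rw [mul_sub, sub_mul q e q, hq]
        abel
      rw [e1]
      exact I.add_mem (I.mul_mem_right _ _ he) (I.mul_mem_left _ _ ih)
  have hlim : Tendsto (fun j => q - y j) atTop (𝓝 (q - 0)) := by
    refine tendsto_const_nhds.sub (squeeze_zero_norm hy ?_)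
    exact (tendsto_pow_atTop_nhds_zero_of_lt_one (norm_nonneg _) h).comp (tendsto_add_atTop_nat 1)
  rw [sub_zero] at hlim
  exact hI.mem_of_tendsto hlim (Eventually.of_forall hmem)

end Ideals

/-! ### Matrix coefficients of operators on `ℓ²(Γ)` -/

section DeltaVectors

open ArrowGroupoid (ell2)

variable {Γ : Type u}

open Classical in
/-- The standard basis vectors of `ℓ²(Γ)`. -/
noncomputable def deltaVector (γ : Γ) : ell2 Γ := lp.single 2 γ (1 : ℂ)

open Classical in
theorem deltaVector_apply (β γ : Γ) : (deltaVector β : ell2 Γ) γ = if γ = β then 1 else 0 := by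
  rw [deltaVector, lp.single_apply, Pi.single_apply]

theorem deltaVector_apply_self (γ : Γ) : (deltaVector γ : ell2 Γ) γ = 1 := by
  rw [deltaVector_apply, if_pos rfl]

theorem deltaVector_apply_of_ne {β γ : Γ} (h : γ ≠ β) : (deltaVector β : ell2 Γ) γ = 0 := by
  rw [deltaVector_apply, if_neg h]

theorem norm_deltaVector (γ : Γ) : ‖(deltaVector γ : ell2 Γ)‖ = 1 := by
  classical
  rw [deltaVector, lp.norm_single (by norm_num), norm_one]

theorem ext_deltaVector {S T : ell2 Γ →L[ℂ] ell2 Γ}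
    (h : ∀ β γ, S (deltaVector β) γ = T (deltaVector β) γ) : S = T := by
  classical
  refine lp.ext_continuousLinearMap (by norm_num) fun β => ContinuousLinearMap.ext_ring ?_
  refine lp.ext (funext fun γ => ?_)
  exact h β γ

theorem norm_apply_deltaVector_apply_le (T : ell2 Γ →L[ℂ] ell2 Γ) (β γ : Γ) :
    ‖T (deltaVector β) γ‖ ≤ ‖T‖ := by
  refine (lp.norm_apply_le_norm (by norm_num) _ γ).trans ((T.le_opNorm _).trans ?_)
  rw [norm_deltaVector, mul_one]

/-- This turns a nonzero operator into one with a positive diagonal coefficient. -/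
theorem star_mul_self_deltaVector_apply (T : ell2 Γ →L[ℂ] ell2 Γ) (γ : Γ) :
    (star T * T) (deltaVector γ) γ = ((‖T (deltaVector γ)‖ ^ 2 : ℝ) : ℂ) := by
  classical
  have h1 : inner ℂ (deltaVector γ) ((star T * T) (deltaVector γ)) =
      (star T * T) (deltaVector γ) γ := by
    conv_lhs => rw [deltaVector]
    rw [lp.inner_single_left]
    simp [deltaVector]
  rw [← h1, mul_apply_eq_comp, ContinuousLinearMap.star_eq_adjoint,
    ContinuousLinearMap.adjoint_inner_right, inner_self_eq_norm_sq_to_K]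
  push_cast
  rfl

end DeltaVectors

/-! ### Convolution operators supported on one group element -/

section ArrowOperators

open ArrowGroupoid (ell2)

variable {X G : Type u} [Group G] [MulAction G X]

/-- The permutation `(x, g) ↦ (k x, g k⁻¹)` of the transformation groupoid. -/
def arrowShift (k : G) : X × G ≃ X × G where
  toFun p := (k • p.1, p.2 * k⁻¹)
  invFun p := (k⁻¹ • p.1, p.2 * k)
  left_inv p := by simp
  right_inv p := by simp

@[simp]
theorem arrowShift_apply (k : G) (p : X × G) : arrowShift k p = (k • p.1, p.2 * k⁻¹) :=
  rfl

variable [TopologicalSpace X] [CompactSpace X]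

theorem sum_norm_arrow_rpow_le (f : C(X, ℂ)) (k : G) (v : ell2 (X × G)) (s : Finset (X × G)) :
    ∑ p ∈ s, ‖f p.1 * v (arrowShift k p)‖ ^ (2 : ENNReal).toReal ≤
      (‖f‖ * ‖v‖) ^ (2 : ENNReal).toReal := by
  rw [Real.mul_rpow (norm_nonneg _) (norm_nonneg _)]
  calc _ ≤ ∑ p ∈ s, ‖f‖ ^ (2 : ENNReal).toReal * ‖v (arrowShift k p)‖ ^ (2 : ENNReal).toReal := by
        refine Finset.sum_le_sum fun p _ => ?_
        rw [norm_mul, Real.mul_rpow (norm_nonneg _) (norm_nonneg _)]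
        gcongr
        exact f.norm_coe_le_norm p.1
    _ = ‖f‖ ^ (2 : ENNReal).toReal *
        ∑ p ∈ s.map (arrowShift k).toEmbedding, ‖v p‖ ^ (2 : ENNReal).toReal := by
        rw [Finset.sum_map, Finset.mul_sum]
        rfl
    _ ≤ _ := by
        gcongr
        exact lp.sum_rpow_le_norm_rpow (by norm_num) v _

/-- The operator of convolution by the function with value `f x` at `(x, k)` and zero elsewhere. -/
noncomputable def arrowOp (f : C(X, ℂ)) (k : G) : ell2 (X × G) →L[ℂ] ell2 (X × G) :=
  LinearMap.mkContinuous
    { toFun := fun v => ⟨fun p => f p.1 * v (arrowShift k p),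
        memℓp_gen' (sum_norm_arrow_rpow_le f k v)⟩
      map_add' := fun v w => by
        ext p
        exact mul_add _ _ _
      map_smul' := fun c v => by
        ext p
        exact mul_left_comm _ _ _ } ‖f‖
    fun v => lp.norm_le_of_forall_sum_le (by norm_num) (by positivity)
      (sum_norm_arrow_rpow_le f k v)

theorem arrowOp_apply (f : C(X, ℂ)) (k : G) (v : ell2 (X × G)) (p : X × G) :
    arrowOp f k v p = f p.1 * v (k • p.1, p.2 * k⁻¹) :=
  rfl

theorem norm_arrowOp_le (f : C(X, ℂ)) (k : G) : ‖arrowOp f k‖ ≤ ‖f‖ :=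
  LinearMap.mkContinuous_norm_le _ (norm_nonneg _) _

theorem arrowOp_ext {T : ell2 (X × G) →L[ℂ] ell2 (X × G)} {f : C(X, ℂ)} {k : G}
    (h : ∀ v p, T v p = f p.1 * v (k • p.1, p.2 * k⁻¹)) : T = arrowOp f k :=
  ContinuousLinearMap.ext fun v => lp.ext (funext fun p => h v p)

theorem smul_arrowOp (c : ℂ) (f : C(X, ℂ)) (k : G) : c • arrowOp f k = arrowOp (c • f) k :=
  arrowOp_ext fun v p => by
    rw [smul_apply, lp.coeFn_smul, Pi.smul_apply, arrowOp_apply,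
      ContinuousMap.smul_apply, smul_eq_mul, smul_eq_mul]
    exact (mul_assoc _ _ _).symm

theorem sum_arrowOp {ι : Type*} (s : Finset ι) (f : ι → C(X, ℂ)) (k : G) :
    ∑ i ∈ s, arrowOp (f i) k = arrowOp (∑ i ∈ s, f i) k :=
  arrowOp_ext fun v p => by
    rw [sum_apply, lp.coeFn_sum, Finset.sum_apply, ContinuousMap.sum_apply,
      Finset.sum_mul]
    rfl

theorem arrowOp_one : arrowOp (1 : C(X, ℂ)) (1 : G) = 1 :=
  (arrowOp_ext fun v p => by simp).symm

open Classical in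
theorem isConvolutionBy_arrowOp (f : C(X, ℂ)) (k : G) :
    (transformationGroupoid X G).IsConvolutionBy (fun p => if p.2 = k then f p.1 else 0)
      (arrowOp f k) := by
  rintro ⟨y, h⟩ ⟨x, g⟩
  change arrowOp f k (deltaVector (y, h)) (x, g) = _
  rw [arrowOp_apply]
  by_cases hc : g • x = h • y
  · rw [if_pos ((transformationGroupoid_comp _ _).mpr hc)]
    change f x * (deltaVector (y, h) : ell2 (X × G)) (k • x, g * k⁻¹) =
      if h⁻¹ * g = k then f x else 0
    by_cases hk : h⁻¹ * g = k
    · subst hk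
      rw [mul_smul, hc, inv_smul_smul, mul_inv_rev, inv_inv, mul_inv_cancel_left,
        deltaVector_apply_self, if_pos rfl, mul_one]
    · rw [if_neg hk, deltaVector_apply_of_ne, mul_zero]
      rw [ne_eq, Prod.mk.injEq]
      rintro ⟨-, rfl⟩
      exact hk (by simp)
  · rw [if_neg, deltaVector_apply_of_ne, mul_zero]
    · rw [ne_eq, Prod.mk.injEq]
      rintro ⟨rfl, rfl⟩
      exact hc (by rw [← mul_smul]; simp)
    · exact fun h' => hc ((transformationGroupoid_comp _ _).mp h')

section

variable [ContinuousConstSMul G X]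

theorem arrowOp_mul_arrowOp (f f' : C(X, ℂ)) (k k' : G) :
    arrowOp f k * arrowOp f' k' =
      arrowOp (f * f'.comp ⟨fun x => k • x, continuous_const_smul k⟩) (k' * k) :=
  arrowOp_ext fun v p => by
    rw [mul_apply_eq_comp, arrowOp_apply, arrowOp_apply]
    simp only [ContinuousMap.mul_apply, ContinuousMap.comp_apply, ContinuousMap.coe_mk, mul_smul,
      mul_inv_rev, mul_assoc]

theorem star_arrowOp (f : C(X, ℂ)) (k : G) :
    star (arrowOp f k) =
      arrowOp (star (f.comp ⟨fun x => k⁻¹ • x, continuous_const_smul k⁻¹⟩)) k⁻¹ := by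
  rw [ContinuousLinearMap.star_eq_adjoint, eq_comm, ContinuousLinearMap.eq_adjoint_iff]
  intro v w
  rw [lp.inner_eq_tsum, lp.inner_eq_tsum, ← (arrowShift k).tsum_eq]
  refine tsum_congr fun p => ?_
  rw [arrowOp_apply, arrowOp_apply]
  simp [mul_comm, mul_assoc]

end

variable [TopologicalSpace G] [DiscreteTopology G]

theorem arrowOp_mem_reducedCStar [T2Space X] (f : C(X, ℂ)) (k : G) :
    arrowOp f k ∈ (transformationGroupoid X G).reducedCStar := by
  classical
  refine NonUnitalStarSubalgebra.le_topologicalClosure _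
    (NonUnitalStarAlgebra.subset_adjoin ℂ _ ⟨_, ?_, ?_, isConvolutionBy_arrowOp f k⟩)
  · refine continuous_prod_of_discrete_right.mpr fun g => ?_
    by_cases h : g = k
    · simpa only [h, if_true] using f.continuous
    · simpa only [h, if_false] using continuous_const
  · refine HasCompactSupport.intro (K := Set.univ ×ˢ {k}) (isCompact_univ.prod isCompact_singleton)
      fun p hp => ?_
    have : p.2 ≠ k := fun h => hp ⟨Set.mem_univ _, h⟩
    simp [this]

/-- As `G` is discrete, a compact support meets finitely many slices `X × {k}`, and an operator is
determined by its matrix coefficients. -/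
theorem mem_span_arrowOp_of_isConvolutionBy {F : X × G → ℂ} (hF : Continuous F)
    (hF' : HasCompactSupport F) {T : ell2 (X × G) →L[ℂ] ell2 (X × G)}
    (hT : (transformationGroupoid X G).IsConvolutionBy F T) :
    T ∈ Submodule.span ℂ {T | ∃ (f : C(X, ℂ)) (k : G), T = arrowOp f k} := by
  classical
  have hfin : (Prod.snd '' tsupport F).Finite :=
    isCompact_iff_finite.mp (IsCompact.image hF' continuous_snd)
  have hzero : ∀ p : X × G, p.2 ∉ hfin.toFinset → F p = 0 := by
    intro p hp
    by_contra h
    exact hp (hfin.mem_toFinset.mpr ⟨p, subset_tsupport F h, rfl⟩)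
  let f : G → C(X, ℂ) := fun k => ⟨fun x => F (x, k), by fun_prop⟩
  have : T = ∑ k ∈ hfin.toFinset, arrowOp (f k) k := by
    refine ext_deltaVector fun β γ => ?_
    refine (hT β γ).trans ?_
    rw [sum_apply, lp.coeFn_sum, Finset.sum_apply]
    have hk : ∀ k, arrowOp (f k) k (deltaVector β) γ = _ :=
      fun k => isConvolutionBy_arrowOp (f k) k β γ
    simp only [hk]
    split_ifs with hc
    · rw [Finset.sum_ite_eq]
      split_ifs with hm
      · rfl
      · exact hzero _ hm
    · simp
  rw [this]
  exact Submodule.sum_mem _ fun k _ => Submodule.subset_span ⟨f k, k, rfl⟩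

variable [ContinuousConstSMul G X]

/-- The span is already closed under products and adjoints, so estimates on the reduced algebra
reduce to single operators `arrowOp f k` and a limit. -/
theorem adjoin_subset_span_arrowOp {T : ell2 (X × G) →L[ℂ] ell2 (X × G)}
    (hT : T ∈ NonUnitalStarAlgebra.adjoin ℂ {T : ell2 (X × G) →L[ℂ] ell2 (X × G) |
      ∃ f : X × G → ℂ, Continuous f ∧ HasCompactSupport f ∧
        (transformationGroupoid X G).IsConvolutionBy f T}) :
    T ∈ Submodule.span ℂ {T | ∃ (f : C(X, ℂ)) (k : G), T = arrowOp f k} := by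
  induction hT using NonUnitalStarAlgebra.adjoin_induction with
  | mem T hT =>
    obtain ⟨F, h1, h2, h3⟩ := hT
    exact mem_span_arrowOp_of_isConvolutionBy h1 h2 h3
  | add S T _ _ hS hT => exact Submodule.add_mem _ hS hT
  | zero => exact Submodule.zero_mem _
  | mul S T _ _ hS hT =>
    have h := Submodule.mul_mem_mul hS hT
    rw [Submodule.span_mul_span] at h
    refine Submodule.span_mono ?_ h
    rintro _ ⟨_, ⟨f, k, rfl⟩, _, ⟨f', k', rfl⟩, rfl⟩
    exact ⟨_, _, arrowOp_mul_arrowOp f f' k k'⟩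
  | smul c T _ hT => exact Submodule.smul_mem _ c hT
  | star T hT' hT =>
    clear hT'
    induction hT using Submodule.span_induction with
    | mem T hT =>
      obtain ⟨f, k, rfl⟩ := hT
      exact Submodule.subset_span ⟨_, _, star_arrowOp f k⟩
    | zero => rw [star_zero]; exact Submodule.zero_mem _
    | add S T _ _ hS hT => rw [star_add]; exact Submodule.add_mem _ hS hT
    | smul c T _ hT => rw [star_smul]; exact Submodule.smul_mem _ _ hT

end ArrowOperators

/-! ### Simplicity of the reduced C*-algebra -/

section Simplicity

open ArrowGroupoid (ell2)

theorem norm_sub_inv_smul_lt_one {E : Type*} [NormedAddCommGroup E] [NormedSpace ℂ E] {d : ℝ}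
    (hd : 0 < d) {q x : E} (h : ‖x - (d : ℂ) • q‖ ≤ d / 2) : ‖q - (d : ℂ)⁻¹ • x‖ < 1 := by
  have hd0 : (d : ℂ) ≠ 0 := by exact_mod_cast hd.ne'
  have e : q - (d : ℂ)⁻¹ • x = -((d : ℂ)⁻¹ • (x - (d : ℂ) • q)) := by
    rw [smul_sub, smul_smul, inv_mul_cancel₀ hd0, one_smul, neg_sub]
  rw [e, norm_neg, norm_smul, norm_inv, Complex.norm_real, Real.norm_of_nonneg hd.le]
  calc d⁻¹ * ‖x - (d : ℂ) • q‖ ≤ d⁻¹ * (d / 2) := by gcongr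
    _ < 1 := by
      field_simp
      norm_num

variable {G : Type u} [Group G] {L : ℕ → Subgroup G} [∀ n, (L n).Normal] {hL : Antitone L}
  [TopologicalSpace G] [DiscreteTopology G]

open Classical in
/-- The characteristic function of a cylinder set. -/
noncomputable def cylinderFn (n : ℕ) (c : G ⧸ L n) : C(profiniteCompletion L hL, ℂ) :=
  ⟨fun x => if x.1 n = c then 1 else 0,
    (continuous_of_discreteTopology (f := fun q : G ⧸ L n => if q = c then (1 : ℂ) else 0)).comp
      (continuous_completion_apply n)⟩

theorem cylinderFn_apply_of_eq {n : ℕ} {c : G ⧸ L n} {x : profiniteCompletion L hL}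
    (h : x.1 n = c) : cylinderFn n c x = 1 :=
  if_pos h

theorem cylinderFn_apply_of_ne {n : ℕ} {c : G ⧸ L n} {x : profiniteCompletion L hL}
    (h : x.1 n ≠ c) : cylinderFn n c x = 0 :=
  if_neg h

variable [∀ n, (L n).FiniteIndex]

theorem norm_arrowOp_cylinderFn_le (n : ℕ) (c : G ⧸ L n) :
    ‖arrowOp (cylinderFn (hL := hL) n c) (1 : G)‖ ≤ 1 := by
  refine (norm_arrowOp_le _ _).trans ((ContinuousMap.norm_le _ zero_le_one).mpr fun x => ?_)
  by_cases h : x.1 n = c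
  · rw [cylinderFn_apply_of_eq h, norm_one]
  · rw [cylinderFn_apply_of_ne h, norm_zero]
    exact zero_le_one

theorem arrowOp_cylinderFn_mul_self (n : ℕ) (c : G ⧸ L n) :
    arrowOp (cylinderFn (hL := hL) n c) (1 : G) * arrowOp (cylinderFn n c) 1 =
      arrowOp (cylinderFn n c) 1 := by
  refine arrowOp_ext fun v p => ?_
  rw [mul_apply_eq_comp, arrowOp_apply, arrowOp_apply]
  by_cases h : p.1.1 n = c
  · simp [cylinderFn_apply_of_eq h]
  · simp [cylinderFn_apply_of_ne h]

/-- `G` permutes the cylinders of level `n` transitively, so an ideal containing one of these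
projections contains all of them. -/
theorem arrowOp_conj_cylinderFn (n : ℕ) {c c' : G ⧸ L n} {k : G}
    (hk : (k : G ⧸ L n) = c * c'⁻¹) :
    arrowOp 1 k * arrowOp (cylinderFn (hL := hL) n c) 1 * arrowOp 1 k⁻¹ =
      arrowOp (cylinderFn n c') 1 := by
  refine arrowOp_ext fun v p => ?_
  rw [mul_apply_eq_comp, mul_apply_eq_comp, arrowOp_apply, arrowOp_apply, arrowOp_apply]
  have hiff : (k • p.1).1 n = c ↔ p.1.1 n = c' := by
    rw [completion_smul_apply, hk, mul_assoc, mul_eq_left, inv_mul_eq_one]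
    exact eq_comm
  by_cases h : p.1.1 n = c'
  · simp [cylinderFn_apply_of_eq h, cylinderFn_apply_of_eq (hiff.mpr h)]
  · simp [cylinderFn_apply_of_ne h, cylinderFn_apply_of_ne (fun h' => h (hiff.mp h'))]

/-- Compression of a convolution operator to the cylinder sets around a point yields
asymptotically a scalar, by freeness of the action. -/
theorem eventually_norm_compress_arrowOp_le (hsep : ⨅ n, L n = ⊥)
    (f : C(profiniteCompletion L hL, ℂ)) (k : G) (γ : profiniteCompletion L hL × G) {ε : ℝ}
    (hε : 0 < ε) : ∀ᶠ n in atTop,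
      ‖arrowOp (cylinderFn n (γ.1.1 n)) (1 : G) * arrowOp f k * arrowOp (cylinderFn n (γ.1.1 n)) 1 -
        (arrowOp f k (deltaVector γ) γ) • arrowOp (cylinderFn n (γ.1.1 n)) 1‖ ≤ ε := by
  by_cases hk : k = 1
  · subst hk
    have hc : arrowOp f (1 : G) (deltaVector γ) γ = f γ.1 := by
      rw [arrowOp_apply, one_smul, inv_one, mul_one, deltaVector_apply_self, mul_one]
    have hV : {y | ‖f y - f γ.1‖ < ε} ∈ 𝓝 γ.1 := by
      have h := f.continuous.continuousAt (x := γ.1)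
      filter_upwards [h (Metric.ball_mem_nhds _ hε)] with y hy
      simpa [dist_eq_norm] using hy
    filter_upwards [eventually_cylinder_subset hV] with n hn
    rw [hc]
    have e : arrowOp (cylinderFn n (γ.1.1 n)) (1 : G) * arrowOp f 1 *
          arrowOp (cylinderFn n (γ.1.1 n)) 1 - (f γ.1) • arrowOp (cylinderFn n (γ.1.1 n)) 1 =
        arrowOp (cylinderFn n (γ.1.1 n) * (f - ContinuousMap.const _ (f γ.1))) 1 := by
      refine arrowOp_ext fun v p => ?_
      rw [sub_apply, smul_apply, mul_apply_eq_comp, mul_apply_eq_comp, lp.coeFn_sub, Pi.sub_apply,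
        lp.coeFn_smul, Pi.smul_apply, arrowOp_apply, arrowOp_apply, arrowOp_apply, arrowOp_apply]
      by_cases h : p.1.1 n = γ.1.1 n
      · simp [cylinderFn_apply_of_eq h, sub_mul]
      · simp [cylinderFn_apply_of_ne h]
    rw [e]
    refine (norm_arrowOp_le _ _).trans ((ContinuousMap.norm_le _ hε.le).mpr fun x => ?_)
    by_cases h : x.1 n = γ.1.1 n
    · simpa [cylinderFn_apply_of_eq h] using (hn x h).le
    · simpa [cylinderFn_apply_of_ne h] using hε.le
  · have hc : arrowOp f k (deltaVector γ) γ = 0 := by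
      rw [arrowOp_apply, deltaVector_apply_of_ne, mul_zero]
      intro h
      exact hk (by simpa using congrArg Prod.snd h)
    obtain ⟨m, hm⟩ : ∃ m, k ∉ L m := by
      by_contra! h
      exact hk (by simpa [hsep] using (Subgroup.mem_iInf.mpr h : k ∈ ⨅ n, L n))
    filter_upwards [eventually_ge_atTop m] with n hn
    have hkn : k ∉ L n := fun h => hm (hL hn h)
    -- Here `k ∉ L n` moves the cylinder off itself.
    have e : arrowOp (cylinderFn n (γ.1.1 n)) (1 : G) * arrowOp f k *
        arrowOp (cylinderFn n (γ.1.1 n)) 1 = 0 := by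
      refine ContinuousLinearMap.ext fun v => lp.ext (funext fun p => ?_)
      rw [mul_apply_eq_comp, mul_apply_eq_comp, arrowOp_apply, arrowOp_apply, arrowOp_apply]
      by_cases h : p.1.1 n = γ.1.1 n
      · have : (k • p.1).1 n ≠ γ.1.1 n := by
          rw [completion_smul_apply, h]
          intro h'
          exact hkn ((QuotientGroup.eq_one_iff k).mp (mul_eq_right.mp h'))
        simp [cylinderFn_apply_of_ne this]
      · simp [cylinderFn_apply_of_ne h]
    rw [e, hc, zero_smul, sub_zero, norm_zero]
    exact hε.le

/-- The compression error is bounded by `‖T‖` uniformly in `n`, which lets the asymptotic estimate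
pass to norm limits. -/
theorem norm_compress_sub_le {γ : profiniteCompletion L hL × G} (n : ℕ)
    (T : ell2 (profiniteCompletion L hL × G) →L[ℂ] ell2 (profiniteCompletion L hL × G)) :
    ‖arrowOp (cylinderFn n (γ.1.1 n)) (1 : G) * T * arrowOp (cylinderFn n (γ.1.1 n)) 1 -
        (T (deltaVector γ) γ) • arrowOp (cylinderFn n (γ.1.1 n)) (1 : G)‖ ≤ 2 * ‖T‖ := by
  set Q := arrowOp (cylinderFn (hL := hL) n (γ.1.1 n)) (1 : G)
  have hQ : ‖Q‖ ≤ 1 := norm_arrowOp_cylinderFn_le _ _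
  have h1 : ‖Q * T * Q‖ ≤ ‖T‖ :=
    calc _ ≤ ‖Q‖ * ‖T‖ * ‖Q‖ := (norm_mul_le _ _).trans (by gcongr; exact norm_mul_le _ _)
      _ ≤ 1 * ‖T‖ * 1 := by gcongr
      _ = ‖T‖ := by ring
  have h2 : ‖(T (deltaVector γ) γ) • Q‖ ≤ ‖T‖ := by
    rw [norm_smul]
    calc _ ≤ ‖T‖ * 1 := by
          gcongr
          exact norm_apply_deltaVector_apply_le T γ γ
      _ = ‖T‖ := mul_one _
  linarith [norm_sub_le (Q * T * Q) ((T (deltaVector γ) γ) • Q)]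

theorem eventually_norm_compress_le (hsep : ⨅ n, L n = ⊥)
    (γ : profiniteCompletion L hL × G)
    {T : ell2 (profiniteCompletion L hL × G) →L[ℂ] ell2 (profiniteCompletion L hL × G)}
    (hT : T ∈ (completionGroupoid L hL).reducedCStar) {ε : ℝ} (hε : 0 < ε) : ∀ᶠ n in atTop,
      ‖arrowOp (cylinderFn n (γ.1.1 n)) (1 : G) * T * arrowOp (cylinderFn n (γ.1.1 n)) 1 -
        (T (deltaVector γ) γ) • arrowOp (cylinderFn n (γ.1.1 n)) (1 : G)‖ ≤ ε := by
  have hspan : ∀ S ∈ Submodule.span ℂ {T : ell2 (profiniteCompletion L hL × G) →L[ℂ]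
      ell2 (profiniteCompletion L hL × G) | ∃ f k, T = arrowOp f k}, ∀ ε : ℝ, 0 < ε →
      ∀ᶠ n in atTop,
      ‖arrowOp (cylinderFn n (γ.1.1 n)) (1 : G) * S * arrowOp (cylinderFn n (γ.1.1 n)) 1 -
        (S (deltaVector γ) γ) • arrowOp (cylinderFn n (γ.1.1 n)) (1 : G)‖ ≤ ε := by
    intro S hS
    induction hS using Submodule.span_induction with
    | mem S hS =>
      obtain ⟨f, k, rfl⟩ := hS
      exact fun ε hε => eventually_norm_compress_arrowOp_le hsep f k γ hε
    | zero =>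
      intro ε hε
      simp [hε.le]
    | add S S' _ _ hS hS' =>
      intro ε hε
      filter_upwards [hS (ε / 2) (half_pos hε), hS' (ε / 2) (half_pos hε)] with n h h'
      rw [mul_add, add_mul, add_apply, lp.coeFn_add, Pi.add_apply, add_smul, add_sub_add_comm]
      exact (norm_add_le _ _).trans (by linarith)
    | smul c S _ hS =>
      intro ε hε
      filter_upwards [hS (ε / (‖c‖ + 1)) (by positivity)] with n h
      rw [mul_smul_comm, smul_mul_assoc, smul_apply, lp.coeFn_smul, Pi.smul_apply, smul_assoc,
        ← smul_sub, norm_smul]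
      calc _ ≤ ‖c‖ * (ε / (‖c‖ + 1)) := by gcongr
        _ ≤ (‖c‖ + 1) * (ε / (‖c‖ + 1)) := by gcongr; linarith
        _ = ε := by field_simp
  -- By the uniform bound, replacing `T` by `S` costs at most `2 * (ε / 4)`, leaving `ε / 2` for the
  -- span.
  obtain ⟨S, hS, hST⟩ := Metric.mem_closure_iff.mp (show T ∈ closure _ from hT) (ε / 4)
    (by positivity)
  filter_upwards [hspan S (adjoin_subset_span_arrowOp hS) (ε / 2) (half_pos hε)] with n hn
  have h := norm_compress_sub_le (γ := γ) n (T - S)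
  rw [dist_eq_norm] at hST
  set Q := arrowOp (cylinderFn (hL := hL) n (γ.1.1 n)) (1 : G)
  have e : Q * T * Q - (T (deltaVector γ) γ) • Q = (Q * S * Q - (S (deltaVector γ) γ) • Q) +
      (Q * (T - S) * Q - ((T - S) (deltaVector γ) γ) • Q) := by
    rw [sub_apply, lp.coeFn_sub, Pi.sub_apply, sub_smul, mul_sub, sub_mul]
    abel
  rw [e]
  exact (norm_add_le _ _).trans (by linarith)

/-- The reduced C*-algebra of the transformation groupoid of a free profinite action of this kind
is simple. -/
theorem hasSimpleReducedCStar_completionGroupoid (hsep : ⨅ n, L n = ⊥) :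
    (completionGroupoid L hL).HasSimpleReducedCStar := by
  have hmem : ∀ f k, arrowOp f k ∈ (completionGroupoid L hL).reducedCStar :=
    fun f k => arrowOp_mem_reducedCStar f k
  constructor
  · refine ⟨⟨arrowOp 1 1, hmem _ _⟩, 0, fun h => ?_⟩
    have h0 : arrowOp (1 : C(profiniteCompletion L hL, ℂ)) (1 : G) = 0 := congrArg Subtype.val h
    rw [arrowOp_one] at h0
    have h1 : (1 : ell2 (profiniteCompletion L hL × G) →L[ℂ] ell2 (profiniteCompletion L hL × G))
        (deltaVector (1, 1)) = 0 := by
      rw [h0]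
      rfl
    have h2 := norm_deltaVector ((1, 1) : profiniteCompletion L hL × G)
    rw [show deltaVector ((1, 1) : profiniteCompletion L hL × G) = 0 from h1, norm_zero] at h2
    exact zero_ne_one h2
  · intro I hI
    refine or_iff_not_imp_left.mpr fun hbot => ?_
    obtain ⟨a, haI, ha⟩ : ∃ a ∈ I, a ≠ 0 := by
      by_contra! h
      exact hbot (eq_bot_iff.mpr fun a ha => (TwoSidedIdeal.mem_bot _).mpr (h a ha))
    obtain ⟨γ, hγ⟩ : ∃ γ, a.1 (deltaVector γ) ≠ 0 := by
      by_contra! h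
      exact ha (Subtype.ext (ext_deltaVector fun β γ => by
        rw [h β]
        rfl))
    set d : ℝ := ‖a.1 (deltaVector γ)‖ ^ 2 with hd
    have hdpos : 0 < d := by positivity
    have hb : (star a * a).1 (deltaVector γ) γ = (d : ℂ) := star_mul_self_deltaVector_apply a.1 γ
    obtain ⟨n, hn⟩ :=
      (eventually_norm_compress_le hsep γ (star a * a).2 (half_pos hdpos)).exists
    rw [hb] at hn
    let Q : ∀ c : G ⧸ L n, (completionGroupoid L hL).reducedCStar :=
      fun c => ⟨arrowOp (cylinderFn n c) 1, hmem _ _⟩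
    let D : (completionGroupoid L hL).reducedCStar :=
      ⟨arrowOp (((d : ℂ)⁻¹) • cylinderFn n (γ.1.1 n)) 1, hmem _ _⟩
    let V : G → (completionGroupoid L hL).reducedCStar := fun k => ⟨arrowOp 1 k, hmem _ _⟩
    -- The element `D * (star a * a) * Q` of `I` is `d⁻¹` times the compression of `star a * a`,
    -- hence within `1 / 2` of the projection `Q`.
    have hQ : Q (γ.1.1 n) ∈ I := by
      refine I.mem_of_norm_sub_lt_one hI (e := D * (star a * a) * Q (γ.1.1 n))
        (Subtype.ext (arrowOp_cylinderFn_mul_self n _))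
        (I.mul_mem_right _ _ (I.mul_mem_left _ _ (I.mul_mem_left _ _ haI))) ?_
      change ‖arrowOp (cylinderFn n (γ.1.1 n)) 1 - arrowOp (((d : ℂ)⁻¹) • cylinderFn n (γ.1.1 n)) 1 *
        (star a * a).1 * arrowOp (cylinderFn n (γ.1.1 n)) 1‖ < 1
      rw [← smul_arrowOp, smul_mul_assoc, smul_mul_assoc]
      exact norm_sub_inv_smul_lt_one hdpos hn
    have hQ' : ∀ c, Q c ∈ I := by
      intro c
      obtain ⟨k, hk⟩ := QuotientGroup.mk_surjective (γ.1.1 n * c⁻¹)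
      have e : V k * Q (γ.1.1 n) * V k⁻¹ = Q c :=
        Subtype.ext (arrowOp_conj_cylinderFn n hk)
      rw [← e]
      exact I.mul_mem_right _ _ (I.mul_mem_left _ _ hQ)
    have : Fintype (G ⧸ L n) := Subgroup.fintypeQuotientOfFiniteIndex
    have hone : ∑ c, Q c ∈ I := sum_mem fun c _ => hQ' c
    -- The cylinders of level `n` partition the completion.
    have hval : (∑ c, Q c : (completionGroupoid L hL).reducedCStar).1 = 1 := by
      rw [AddSubmonoidClass.coe_finsetSum]
      change ∑ c, arrowOp (cylinderFn n c) (1 : G) = _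
      rw [sum_arrowOp, ← arrowOp_one]
      congr 1
      ext x
      rw [ContinuousMap.sum_apply, Finset.sum_eq_single (x.1 n)
        (fun c _ hc => cylinderFn_apply_of_ne hc.symm) (by simp), cylinderFn_apply_of_eq rfl]
      rfl
    refine eq_top_iff.mpr fun b _ => ?_
    have : b = b * ∑ c, Q c := Subtype.ext (by
      rw [MulMemClass.coe_mul, hval, mul_one])
    rw [this]
    exact I.mul_mem_left _ _ hone

end Simplicity

theorem theorem10 {G : Type u} [Group G] [TopologicalSpace G] [DiscreteTopology G] [Countable G]
    [Infinite G] (hG : IsAmenableGroup G) (L : ℕ → Subgroup G) [∀ n, (L n).Normal]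
    [∀ n, (L n).FiniteIndex] (hL : Antitone L) (hsep : ⨅ n, L n = ⊥) :
    (completionGroupoid L hL).IsAlmostAF ∧
    (∃ (K : ℕ → Finset G) (ν : ℕ → ℕ), IsFolnerTiling L K ν ∧ ∀ g, ∃ n, g ∈ K n) ∧
    ∀ (K : ℕ → Finset G) (ν : ℕ → ℕ), IsFolnerTiling L K ν →
      (∀ n, (completionGroupoid L hL).IsWideSubgroupoid (tileSubgroupoid L hL K n) ∧
        IsCompact (tileSubgroupoid L hL K n) ∧ IsOpen (tileSubgroupoid L hL K n)) ∧
      Monotone (fun k => tileSubgroupoid L hL K (ν k)) ∧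
      (completionGroupoid L hL).IsLargeAFSubgroupoid (⋃ k, tileSubgroupoid L hL K (ν k)) := by
  have hlarge := fun K ν (h : IsFolnerTiling L K ν) => h.isLargeAFSubgroupoid (hL := hL) hsep
  obtain ⟨K, ν, hK, hKG⟩ := exists_isFolnerTiling hG L hL hsep
  refine ⟨⟨isCantor_transformationGroupoid (completion_homeomorph_cantorSet hsep),
    hasSimpleReducedCStar_completionGroupoid hsep, _, hlarge K ν hK⟩, ⟨K, ν, hK, hKG⟩,
    fun K ν h => ⟨fun n => ⟨isWideSubgroupoid_tileSubgroupoid (h.tiling n),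
      isCompact_isOpen_tileSubgroupoid n⟩, h.monotone_tileSubgroupoid, hlarge K ν h⟩⟩
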